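/- Setting. Let $d,k\ge 0$. Let $\hat T_r$ ($r$ in a finite index set) be reference elements: each $\hat T_r\subset\mathbb R^d$ is a polytope with nonempty interior, with a space $\hat V_r\subset\mathbb P_k$ of polynomials of total degree at most $k$ and finitely many generalized nodes $(\alpha,\hat\xi)$, where $\alpha$ is a multi-index and $\hat\xi\in\hat T_r$. For each $r$ let $\mathcal K_r$ be a compact set of invertible $d\times d$ matrices (the admissible shapes). For $h>0$, an element of size $h$ is $T=F_T(\hat T_r)$ with $F_T(\hat x)=hB\hat x+b$, $B\in\mathcal K_r$, $b\in\mathbb R^d$; its finite element space is $V_h(T)=\{v: v\circ F_T\in\hat V_r\}$ and its generalized nodes are $\mathcal X_T=\{(\alpha,F_T(\hat\xi))\}$. For a generalized node $x=(\alpha_x,\xi_x)$ put $\varphi_x^*(v)=D^{\alpha_x}v(\xi_x)$. Assume that for every such $T$ the functionals $\{\varphi_x^*\}_{x\in\mathcal X_T}$ form a basis of the dual of $V_h(T)$, and let $\{\varphi_{T,x}\}_{x\in\mathcal X_T}\subset V_h(T)$ be the Lagrange basis, $\varphi_y^*(\varphi_{T,x})=\delta_{xy}$. A mesh $\widetilde{\mathcal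 T}_h$ is a set of elements of size $h$ with pairwise disjoint interiors such that $x\in\mathcal X_T$ and $\xi_x\in T'$ imply $x\in\mathcal X_{T'}$, for all $T,T'\in\widetilde{\mathcal T}_h$. For $\Omega\subset\mathbb R^d$ let $\mathcal T_h=\{T\in\widetilde{\mathcal T}_h: T\cap\Omega\neq\emptyset\}$ be the active mesh, assumed finite; let $W_h=\bigoplus_{T\in\mathcal T_h}\mathbb P_k(T)$, $\mathcal X_h=\bigcup_{T\in\mathcal T_h}\mathcal X_T$, $\mathcal T_h(x)=\{T\in\mathcal T_h:\xi_x\in T\}$. For $x\in\mathcal X_h$ let $\varphi_x\in W_h$ equal $\varphi_{T,x}$ on $T\in\mathcal T_h(x)$ and $0$ on the other elements, and let $V_h=\mathrm{span}\{\varphi_x:x\in\mathcal X_h\}$. Given weights $\kappa_{T,x}\ge0$ with $\sum_{T\in\mathcal T_h(x)}\kappa_{T,x}=1$ for every $x\in\mathcal X_h$, define the nodal averaging operator $$A_hw=\sum_{x\in\mathcal X_h}\Big(\sum_{T\in\mathcal T_h(x)}\kappa_{T,x}\,\varphi_x^*(w|_T)\Big)\varphi_x,\qquad w\in W_h .$$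 Let $\|w\|_{\mathcal T_h}^2=\sum_{T\in\mathcal T_h}\|w\|_{L^2(T)}^2$ and $\|\nabla^jw\|_{\mathcal T_h}^2=\sum_{T\in\mathcal T_h}\|\nabla^jw\|_{L^2(T)}^2$, where $\nabla^jw$ is the tensor of all partial derivatives of order $j$, taken elementwise, with its Euclidean norm. Lemma. There is a constant $C>0$, depending only on the reference elements (hence $d,k$) and the sets $\mathcal K_r$, such that for every $h>0$, every mesh with mesh parameter $h$, every $\Omega$ with finite active mesh and every choice of weights: 1. $A_h$ maps $W_h$ into $V_h$ and is linear; 2. $A_hv=v$ for all $v\in V_h$; 3. $\|A_hw\|_{\mathcal T_h}\le C\|w\|_{\mathcal T_h}$ for all $w\in W_h$; 4. for all $j\ge0$ and $w\in W_h$, $$\|\nabla^jA_hw\|_{\mathcal T_h}\le C\Big(h^{-j}\inf_{v'\in V_h}\|w-v'\|_{\mathcal T_h}+\|\nabla^jw\|_{\mathcal T_h}\Big).$$ -/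

import Mathlib

noncomputable section

namespace NodalFEM

open scoped Classical

/-- `ℙ_k`: the real polynomials in `d` variables of total degree at most `k`.  On a set with
nonempty interior a polynomial function and the polynomial determine each other, so `ℙ_k(T)` is
this space for every element `T`. -/
abbrev Pk (d k : ℕ) : Type := MvPolynomial.restrictTotalDegree (Fin d) ℝ k

/-- The partial differential operator `D^α = ∂₁^{α₁} ⋯ ∂_d^{α_d}`. -/
def multiDeriv {d : ℕ} (α : Fin d → ℕ) : Module.End ℝ (MvPolynomial (Fin d) ℝ) :=
  (List.ofFn fun i : Fin d => (MvPolynomial.pderiv i).toLinearMap ^ α i).prod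

/-- The entry `∂_{s 0} ⋯ ∂_{s (j-1)}` of the tensor `∇^j` of all partial derivatives of
order `j`. -/
def tensorDeriv {d j : ℕ} (s : Fin j → Fin d) : Module.End ℝ (MvPolynomial (Fin d) ℝ) :=
  (List.ofFn fun a : Fin j => (MvPolynomial.pderiv (R := ℝ) (s a)).toLinearMap).prod

/-- A generalized node `x = (α_x, ξ_x)`: a multi-index and a physical point. -/
structure GenNode (d : ℕ) where
  idx : Fin d → ℕ
  pt : Fin d → ℝ

/-- The nodal degree of freedom `φ*_x(v) = D^{α_x} v (ξ_x)`. -/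
def dof {d k : ℕ} (x : GenNode d) : Pk d k →ₗ[ℝ] ℝ :=
  (MvPolynomial.aeval x.pt).toLinearMap ∘ₗ multiDeriv x.idx ∘ₗ Submodule.subtype _

/-- The functionals `φ*_x`, `x ∈ X`, form a basis of the dual space of `V`. -/
def IsDualBasis {d k : ℕ} (V : Submodule ℝ (Pk d k)) (X : Finset (GenNode d)) : Prop :=
  LinearIndependent ℝ (fun x : X => ((dof x.1).domRestrict V : Module.Dual ℝ V)) ∧
  Submodule.span ℝ (Set.range fun x : X => ((dof x.1).domRestrict V : Module.Dual ℝ V)) = ⊤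

/-- The Lagrange basis function `φ_x ∈ V`, determined by `φ*_y(φ_x) = δ_{xy}` for `y ∈ X`. -/
def lagrangeBasis {d k : ℕ} (V : Submodule ℝ (Pk d k)) (X : Finset (GenNode d))
    (x : GenNode d) : Pk d k :=
  if h : ∃ v ∈ V, ∀ y ∈ X, dof y v = if y = x then 1 else 0 then h.choose else 0

/-- If the functionals form a basis of the dual, the defining equations of the Lagrange basis
have exactly one solution. -/
theorem IsDualBasis.existsUnique {d k : ℕ} {V : Submodule ℝ (Pk d k)} {X : Finset (GenNode d)}
    (h : IsDualBasis V X) {x : GenNode d} (hx : x ∈ X) :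
    ∃! v : Pk d k, v ∈ V ∧ ∀ y ∈ X, dof y v = if y = x then 1 else 0 := by
  have : Module.Finite ℝ (Pk d k) := inferInstance
  have : Module.Finite ℝ V := Module.Finite.of_injective V.subtype V.injective_subtype
  have : Module.Free ℝ V := Module.Free.of_divisionRing ℝ V
  have : Module.IsReflexive ℝ V := Module.IsReflexive.of_finite_of_free ℝ V
  let b : Module.Basis X ℝ (Module.Dual ℝ V) := Module.Basis.mk h.1 h.2.ge
  have hb : ∀ y : X, b y = (dof y.1).domRestrict V := fun y => by simp [b]
  let v : V := (Module.evalEquiv ℝ V).symm (b.coord ⟨x, hx⟩)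
  have hv : ∀ f : Module.Dual ℝ V, f v = b.coord ⟨x, hx⟩ f := fun f => by
    simp [v, Module.apply_evalEquiv_symm_apply]
  refine ⟨v, ⟨v.2, fun y hy => ?_⟩, ?_⟩
  · have h1 := hv (b ⟨y, hy⟩)
    rw [hb] at h1
    rw [← hb, Module.Basis.coord_apply, Module.Basis.repr_self, Finsupp.single_apply] at h1
    rw [hb] at h1
    simpa using h1
  · rintro w ⟨hwV, hw⟩
    have key : (⟨w, hwV⟩ : V) = v := by
      apply (Module.evalEquiv ℝ V).injective
      apply b.ext
      intro y
      have h1 := hv (b y)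
      rw [Module.Basis.coord_apply, Module.Basis.repr_self, Finsupp.single_apply] at h1
      rw [Module.evalEquiv_apply, Module.evalEquiv_apply, Module.Dual.eval_apply,
        Module.Dual.eval_apply, h1, hb]
      have h2 := hw y.1 y.2
      simp only [LinearMap.domRestrict_apply, h2]
      simp [Subtype.ext_iff]
    exact congrArg Subtype.val key

theorem lagrangeBasis_spec {d k : ℕ} {V : Submodule ℝ (Pk d k)} {X : Finset (GenNode d)}
    (h : IsDualBasis V X) {x : GenNode d} (hx : x ∈ X) :
    lagrangeBasis V X x ∈ V ∧
      ∀ y ∈ X, dof y (lagrangeBasis V X x) = if y = x then 1 else 0 := by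
  have h' : ∃ v ∈ V, ∀ y ∈ X, dof y v = if y = x then 1 else 0 := (h.existsUnique hx).exists
  rw [lagrangeBasis, dif_pos h']
  exact h'.choose_spec

/-- The affine map `x ↦ A x + b`. -/
def affineMap {d : ℕ} (A : Matrix (Fin d) (Fin d) ℝ) (b : Fin d → ℝ) (x : Fin d → ℝ) :
    Fin d → ℝ :=
  A.mulVec x + b

/-- The composition `p ∘ F` of a polynomial with the affine map `F x = A x + b`. -/
def pullback {d : ℕ} (A : Matrix (Fin d) (Fin d) ℝ) (b : Fin d → ℝ) :
    MvPolynomial (Fin d) ℝ →ₗ[ℝ] MvPolynomial (Fin d) ℝ :=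
  (MvPolynomial.bind₁ fun i =>
    (∑ j, MvPolynomial.C (A i j) * MvPolynomial.X j) + MvPolynomial.C (b i)).toLinearMap

theorem eval_pullback {d : ℕ} (A : Matrix (Fin d) (Fin d) ℝ) (b x : Fin d → ℝ)
    (p : MvPolynomial (Fin d) ℝ) :
    MvPolynomial.eval x (pullback A b p) = MvPolynomial.eval (affineMap A b x) p := by
  simp only [pullback, AlgHom.toLinearMap_apply, ← MvPolynomial.aeval_eq_eval,
    MvPolynomial.aeval_bind₁]
  congr 2
  funext i
  simp [affineMap, Matrix.mulVec, dotProduct]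

/-- A reference element: a polytope with nonempty interior, a space of polynomials of degree at
most `k`, and finitely many generalized nodes located in the polytope. -/
structure RefElement (d k : ℕ) where
  vertices : Finset (Fin d → ℝ)
  interior_nonempty : (interior (convexHull ℝ (vertices : Set (Fin d → ℝ)))).Nonempty
  space : Submodule ℝ (Pk d k)
  nodes : Finset (GenNode d)
  nodes_mem : ∀ x ∈ nodes, x.pt ∈ convexHull ℝ (vertices : Set (Fin d → ℝ))

namespace RefElement

variable {d k : ℕ} (E : RefElement d k) (A : Matrix (Fin d) (Fin d) ℝ) (b : Fin d → ℝ)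

/-- The physical element `T = F(T̂)`, where `F x = A x + b`; it is a closed set. -/
def image : Set (Fin d → ℝ) :=
  affineMap A b '' convexHull ℝ (E.vertices : Set (Fin d → ℝ))

/-- The element finite element space `V_h(T) = {v : v ∘ F ∈ V̂}`. -/
def imageSpace : Submodule ℝ (Pk d k) :=
  (E.space.map (Submodule.subtype _)).comap (pullback A b ∘ₗ Submodule.subtype _)

/-- The generalized nodes `(α, F(ξ̂))` of the physical element; the derivatives `D^α` are taken
with respect to the physical coordinates. -/
def imageNodes : Finset (GenNode d) :=
  E.nodes.image fun x => ⟨x.idx, affineMap A b x.pt⟩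

end RefElement

/-- The finite elements that the meshes may use: finitely many reference elements, indexed by
`ρ`, and for each of them a compact set of invertible matrices, the admissible shapes.  An element
of size `h` is an image under `x ↦ h B x + b` with `B` admissible; compactness in the invertible
matrices is shape regularity together with quasiuniformity.  On every element of admissible shape
the nodal degrees of freedom form a basis of the dual of the element space. -/
structure ElementFamily (d k : ℕ) (ρ : Type) where
  ref : ρ → RefElement d k
  shapes : ρ → Set (Matrix (Fin d) (Fin d) ℝ)
  shapes_compact : ∀ r, IsCompact (shapes r)
  shapes_invertible : ∀ r, ∀ B ∈ shapes r, IsUnit B.det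
  unisolvent : ∀ r, ∀ B ∈ shapes r, ∀ h : ℝ, 0 < h → ∀ b : Fin d → ℝ,
    IsDualBasis ((ref r).imageSpace (h • B) b) ((ref r).imageNodes (h • B) b)

/-- An element of size `h`, given by a reference element, an admissible shape and a
translation. -/
structure Cell {d k : ℕ} {ρ : Type} (F : ElementFamily d k ρ) where
  type : ρ
  shape : Matrix (Fin d) (Fin d) ℝ
  shape_mem : shape ∈ F.shapes type
  shift : Fin d → ℝ

namespace Cell

variable {d k : ℕ} {ρ : Type} {F : ElementFamily d k ρ} (h : ℝ) (T : Cell F)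

def carrier : Set (Fin d → ℝ) := (F.ref T.type).image (h • T.shape) T.shift

/-- `V_h(T)`. -/
def space : Submodule ℝ (Pk d k) := (F.ref T.type).imageSpace (h • T.shape) T.shift

/-- `𝒳_T`. -/
def nodes : Finset (GenNode d) := (F.ref T.type).imageNodes (h • T.shape) T.shift

end Cell

/-- A mesh with mesh parameter `h`: a set of elements with pairwise disjoint interiors, such that
a generalized node of one element is a generalized node of every element that contains its
physical point. -/
structure Mesh {d k : ℕ} {ρ : Type} (F : ElementFamily d k ρ) (h : ℝ) where
  cells : Set (Cell F)
  disjoint_interiors : ∀ T ∈ cells, ∀ T' ∈ cells, T ≠ T' →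
    Disjoint (interior (T.carrier h)) (interior (T'.carrier h))
  nodes_shared : ∀ T ∈ cells, ∀ T' ∈ cells, ∀ x ∈ T.nodes h,
    x.pt ∈ T'.carrier h → x ∈ T'.nodes h

namespace Mesh

variable {d k : ℕ} {ρ : Type} {F : ElementFamily d k ρ} {h : ℝ}

/-- The active mesh `{T : T ∩ Ω ≠ ∅}`. -/
def active (M : Mesh F h) (Ω : Set (Fin d → ℝ)) : Mesh F h where
  cells := {T | T ∈ M.cells ∧ (T.carrier h ∩ Ω).Nonempty}
  disjoint_interiors T hT T' hT' := M.disjoint_interiors T hT.1 T' hT'.1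
  nodes_shared T hT T' hT' := M.nodes_shared T hT.1 T' hT'.1

variable (M : Mesh F h)

/-- `W_h = ⨁_T ℙ_k(T)`, the discontinuous piecewise polynomials (used for finite meshes). -/
abbrev Wh : Type := M.cells → Pk d k

variable [Fintype M.cells]

/-- `‖w‖_{𝒯_h}`, where `‖w‖²_{𝒯_h} = ∑_T ‖w‖²_T`. -/
def l2norm (w : M.Wh) : ℝ :=
  √(∑ T : M.cells, ∫ y in T.1.carrier h, (MvPolynomial.eval y (w T).1) ^ 2)

/-- `‖∇^j w‖_{𝒯_h}`, where `∇^j` is taken elementwise. -/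
def gradNorm (j : ℕ) (w : M.Wh) : ℝ :=
  √(∑ T : M.cells, ∫ y in T.1.carrier h,
    ∑ s : Fin j → Fin d, (MvPolynomial.eval y (tensorDeriv s (w T).1)) ^ 2)

/-- `𝒳_h`, the set of all global generalized nodes. -/
def nodes : Finset (GenNode d) := Finset.univ.biUnion fun T : M.cells => T.1.nodes h

/-- `𝒯_h(x)`, the elements that contain the physical point of `x`. -/
def cellsAt (x : GenNode d) : Finset M.cells :=
  Finset.univ.filter fun T : M.cells => x.pt ∈ T.1.carrier h

/-- The global basis function `φ_x`: it is `φ_{T,x}` on the elements `T ∈ 𝒯_h(x)` and zero on the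
other elements. -/
def basisFun (x : GenNode d) : M.Wh := fun T =>
  if T ∈ M.cellsAt x then lagrangeBasis (T.1.space h) (T.1.nodes h) x else 0

/-- `V_h`, the space spanned by the global basis functions. -/
def Vh : Submodule ℝ M.Wh := Submodule.span ℝ (M.basisFun '' (M.nodes : Set (GenNode d)))

/-- Averaging weights: at every node they are nonnegative and sum to one. -/
def IsWeight (κ : M.cells → GenNode d → ℝ) : Prop :=
  ∀ x ∈ M.nodes, (∀ T ∈ M.cellsAt x, 0 ≤ κ T x) ∧ ∑ T ∈ M.cellsAt x, κ T x = 1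

/-- The average `⟨φ*_x(w)⟩_x = ∑_{T ∈ 𝒯_h(x)} κ_{T,x} φ*_{T,x}(w_T)`. -/
def nodalAverage (κ : M.cells → GenNode d → ℝ) (w : M.Wh) (x : GenNode d) : ℝ :=
  ∑ T ∈ M.cellsAt x, κ T x * dof x (w T)

/-- The nodal averaging operator `A_h w = ∑_{x ∈ 𝒳_h} ⟨φ*_x(w)⟩_x φ_x`. -/
def average (κ : M.cells → GenNode d → ℝ) (w : M.Wh) : M.Wh :=
  ∑ x ∈ M.nodes, M.nodalAverage κ w x • M.basisFun x

end Mesh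

end NodalFEM

end

noncomputable section

namespace NodalFEM

open scoped Classical
open MeasureTheory

/-! ### Polynomials: degrees, affine pullbacks and derivatives -/

section Polynomials

variable {d k : ℕ}

/-! Everything is transported to the reference elements. Under `x ↦ h B x + b` the squared `L²` norm
acquires the factor `h ^ d * |det B|`, and `h ^ |α| * dof x` becomes `refDof B⁻¹ x`, which depends
on the shape `B` but not on `h` or `b` (`dof_smul_affineMap`). What remains is to compare quadratic
forms on a finite-dimensional polynomial space that vary continuously with `B` in a compact set, and
`exists_uniform_quadratic_bound` does this uniformly. It bounds the scaled degrees of freedom by the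
`L²` norm on all of `Pk` (`exists_dof_le`) and, by unisolvence, the `L²` norm by the degrees of
freedom on the element space (`exists_le_dof`).

For `L²` stability, the degrees of freedom of `A_h w` on `T` are the nodal averages (`dof_average`),
hence controlled by those of `w` on the elements sharing a node with `T`. Summation over `T` costs
only a constant, since boundedly many elements meet at a point: their interiors are disjoint, have
volume of order at least `h ^ d`, and lie in a ball of radius of order `h` (`exists_overlap_bound`).

The projection property follows from duality between global basis functions and degrees of freedom
(`dof_basisFun`), which relies on the sharing of nodes between elements. For the derivative bound
put `u = w - v'` with `v' ∈ V_h`; then `A_h w = (A_h u - u) + w`. The inverse estimate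
`exists_gradSq_le` and `L²` stability bound the first term by `h ^ (-j) * ‖u‖`, and one takes the
infimum over `v'`. -/

theorem totalDegree_pderiv_le (i : Fin d) (p : MvPolynomial (Fin d) ℝ) :
    (MvPolynomial.pderiv i p).totalDegree ≤ p.totalDegree - 1 := by
  conv_lhs => rw [p.as_sum, map_sum]
  refine MvPolynomial.totalDegree_finsetSum_le fun s hs => ?_
  rw [MvPolynomial.pderiv_monomial]
  by_cases hi : s i = 0
  · simp [hi]
  · refine (MvPolynomial.totalDegree_monomial_le _ _).trans ?_
    have h1 := MvPolynomial.le_totalDegree hs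
    have h2 : (Finsupp.single i 1 : Fin d →₀ ℕ) ≤ s := by
      rw [Finsupp.single_le_iff]; omega
    have h3 : (s - Finsupp.single i 1).degree + (Finsupp.single i 1 : Fin d →₀ ℕ).degree
        = s.degree := by
      rw [← map_add, tsub_add_cancel_of_le h2]
    rw [Finsupp.degree_single] at h3
    change s.degree ≤ _ at h1
    change Finsupp.degree _ ≤ _
    omega

theorem totalDegree_pullback_le (A : Matrix (Fin d) (Fin d) ℝ) (b : Fin d → ℝ)
    (p : MvPolynomial (Fin d) ℝ) : (pullback A b p).totalDegree ≤ p.totalDegree := by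
  have hdeg : ∀ i, ((∑ j, MvPolynomial.C (A i j) * MvPolynomial.X j) +
      MvPolynomial.C (b i) : MvPolynomial (Fin d) ℝ).totalDegree ≤ 1 := fun i => by
    refine (MvPolynomial.totalDegree_add _ _).trans (max_le ?_ (by simp))
    refine MvPolynomial.totalDegree_finsetSum_le fun j _ => ?_
    exact (MvPolynomial.totalDegree_mul _ _).trans (by simp)
  conv_lhs => rw [p.as_sum, map_sum]
  refine MvPolynomial.totalDegree_finsetSum_le fun s hs => ?_
  rw [pullback, AlgHom.toLinearMap_apply, MvPolynomial.bind₁_monomial]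
  refine (MvPolynomial.totalDegree_mul _ _).trans ?_
  rw [MvPolynomial.totalDegree_C, zero_add]
  refine (MvPolynomial.totalDegree_finsetProd _ _).trans
    (le_trans ?_ (MvPolynomial.le_totalDegree hs))
  refine Finset.sum_le_sum fun i _ => (MvPolynomial.totalDegree_pow _ _).trans ?_
  simpa using Nat.mul_le_mul_left (s i) (hdeg i)

theorem pullback_mem_Pk (A : Matrix (Fin d) (Fin d) ℝ) (b : Fin d → ℝ)
    {p : MvPolynomial (Fin d) ℝ} (hp : p ∈ MvPolynomial.restrictTotalDegree (Fin d) ℝ k) :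
    pullback A b p ∈ MvPolynomial.restrictTotalDegree (Fin d) ℝ k := by
  rw [MvPolynomial.mem_restrictTotalDegree] at hp ⊢
  exact (totalDegree_pullback_le A b p).trans hp

theorem pullback_pullback_inv {A : Matrix (Fin d) (Fin d) ℝ} (hA : IsUnit A.det)
    (p : MvPolynomial (Fin d) ℝ) : pullback A 0 (pullback A⁻¹ 0 p) = p := by
  refine MvPolynomial.funext fun x => ?_
  rw [eval_pullback, eval_pullback]
  simp [affineMap, Matrix.mulVec_mulVec, Matrix.nonsing_inv_mul A hA]

/-- The chain rule for the composition of a polynomial with an affine map. -/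
theorem pderiv_pullback (A : Matrix (Fin d) (Fin d) ℝ) (b : Fin d → ℝ) (l : Fin d)
    (p : MvPolynomial (Fin d) ℝ) :
    MvPolynomial.pderiv l (pullback A b p) =
      ∑ i, A i l • pullback A b (MvPolynomial.pderiv i p) := by
  induction p using MvPolynomial.induction_on with
  | C a => simp [pullback]
  | add p q hp hq => simp [hp, hq, Finset.sum_add_distrib]
  | mul_X p n hp =>
    have hX : MvPolynomial.pderiv l (pullback A b (MvPolynomial.X n)) =
        MvPolynomial.C (A n l) := by
      simp only [pullback, AlgHom.toLinearMap_apply, MvPolynomial.bind₁_X_right, map_add, map_sum,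
        MvPolynomial.pderiv_C_mul, MvPolynomial.pderiv_C, MvPolynomial.pderiv_X, add_zero]
      simp [Pi.single_apply]
    have hmul : ∀ q r : MvPolynomial (Fin d) ℝ,
        pullback A b (q * r) = pullback A b q * pullback A b r := fun q r => by
      simp [pullback]
    have hone : ∀ i, pullback A b (MvPolynomial.pderiv i (MvPolynomial.X n)) =
        if i = n then 1 else 0 := fun i => by
      rw [MvPolynomial.pderiv_X, Pi.single_apply]
      by_cases h : n = i <;> simp [pullback, h, eq_comm]
    simp only [hmul, MvPolynomial.pderiv_mul, hX, hp, map_add, hone, smul_add,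
      Finset.sum_add_distrib, Finset.sum_mul, mul_ite, mul_one, mul_zero, smul_ite, smul_zero,
      smul_mul_assoc]
    simp [MvPolynomial.smul_eq_C_mul, mul_comm]

/-- The directional derivative `∑ l, G l i ∂_l`: the derivative `∂_i` in coordinates related to the
given ones by an affine map with inverse linear part `G`. -/
def pulledDeriv (G : Matrix (Fin d) (Fin d) ℝ) (i : Fin d) :
    Module.End ℝ (MvPolynomial (Fin d) ℝ) :=
  ∑ l, G l i • (MvPolynomial.pderiv l).toLinearMap

theorem pullback_pderiv {A : Matrix (Fin d) (Fin d) ℝ} (hA : IsUnit A.det) (b : Fin d → ℝ)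
    (i : Fin d) (p : MvPolynomial (Fin d) ℝ) :
    pullback A b (MvPolynomial.pderiv i p) = pulledDeriv A⁻¹ i (pullback A b p) := by
  -- The chain rule expresses derivatives of the pullback through pulled-back derivatives with
  -- coefficients from `A`; contracting with `A⁻¹` inverts this relation.
  have h1 : ∀ m, ∑ l, A⁻¹ l i * A m l = if m = i then 1 else 0 := fun m => by
    have := congrFun (congrFun (Matrix.mul_nonsing_inv A hA) m) i
    simpa [Matrix.mul_apply, Matrix.one_apply, mul_comm] using this
  simp only [pulledDeriv, LinearMap.sum_apply, LinearMap.smul_apply, Derivation.coeFn_coe,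
    pderiv_pullback, Finset.smul_sum, smul_smul]
  rw [Finset.sum_comm]
  simp [← Finset.sum_smul, h1]

/-- The operator `D^α` in coordinates related to the given ones by an affine map with inverse
linear part `G`. -/
def pulledMultiDeriv (G : Matrix (Fin d) (Fin d) ℝ) (α : Fin d → ℕ) :
    Module.End ℝ (MvPolynomial (Fin d) ℝ) :=
  (List.ofFn fun i : Fin d => pulledDeriv G i ^ α i).prod

/-- An intertwining relation passes through one factor at a time. The order of the factors is kept,
so no commutation of derivatives is needed. -/
theorem comp_list_ofFn_prod {V : Type*} [AddCommGroup V] [Module ℝ V] {n : ℕ}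
    (P : Module.End ℝ V) {f g : Fin n → Module.End ℝ V} (h : ∀ i, P * f i = g i * P) :
    P * (List.ofFn f).prod = (List.ofFn g).prod * P := by
  induction n with
  | zero => simp
  | succ n ih =>
    rw [List.ofFn_succ, List.ofFn_succ, List.prod_cons, List.prod_cons, ← mul_assoc, h,
      mul_assoc, ih fun i => h i.succ, mul_assoc]

theorem list_ofFn_smul_prod {V : Type*} [AddCommGroup V] [Module ℝ V] {n : ℕ}
    (c : Fin n → ℝ) (f : Fin n → Module.End ℝ V) :
    (List.ofFn fun i => c i • f i).prod = (∏ i, c i) • (List.ofFn f).prod := by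
  induction n with
  | zero => simp
  | succ n ih =>
    rw [List.ofFn_succ, List.ofFn_succ, List.prod_cons, List.prod_cons, ih, Fin.prod_univ_succ,
      smul_mul_smul_comm]

theorem pullback_multiDeriv {A : Matrix (Fin d) (Fin d) ℝ} (hA : IsUnit A.det) (b : Fin d → ℝ)
    (α : Fin d → ℕ) (p : MvPolynomial (Fin d) ℝ) :
    pullback A b (multiDeriv α p) = pulledMultiDeriv A⁻¹ α (pullback A b p) := by
  have h1 : ∀ i, pullback A b * (MvPolynomial.pderiv i).toLinearMap =
      pulledDeriv A⁻¹ i * pullback A b := fun i =>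
    LinearMap.ext fun q => pullback_pderiv hA b i q
  have h2 : ∀ i, pullback A b * (MvPolynomial.pderiv i).toLinearMap ^ α i =
      pulledDeriv A⁻¹ i ^ α i * pullback A b := fun i =>
    (SemiconjBy.pow_right (h1 i : SemiconjBy _ _ _) (α i))
  exact LinearMap.congr_fun (comp_list_ofFn_prod (pullback A b) h2) p

/-- Homogeneity of an operator of order `|α|` in the inverse linear part; this is the source of the
weight `h ^ |α|` on the degrees of freedom. -/
theorem pulledMultiDeriv_smul (c : ℝ) (G : Matrix (Fin d) (Fin d) ℝ) (α : Fin d → ℕ) :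
    pulledMultiDeriv (c • G) α = c ^ (∑ i, α i) • pulledMultiDeriv G α := by
  have h1 : ∀ i, pulledDeriv (c • G) i = c • pulledDeriv G i := fun i => by
    simp [pulledDeriv, Finset.smul_sum, smul_smul]
  simp only [pulledMultiDeriv, h1, smul_pow]
  rw [list_ofFn_smul_prod (fun i => c ^ α i) fun i => pulledDeriv G i ^ α i,
    Finset.prod_pow_eq_pow_sum]

theorem dof_affineMap {A : Matrix (Fin d) (Fin d) ℝ} (hA : IsUnit A.det) (b : Fin d → ℝ)
    (α : Fin d → ℕ) (y : Fin d → ℝ) (w : Pk d k) :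
    dof ⟨α, affineMap A b y⟩ w =
      MvPolynomial.eval y (pulledMultiDeriv A⁻¹ α (pullback A b w.1)) := by
  rw [← pullback_multiDeriv hA, eval_pullback]
  simp [dof, MvPolynomial.aeval_eq_eval]

theorem totalDegree_tensorDeriv_le {j : ℕ} (s : Fin j → Fin d) (p : MvPolynomial (Fin d) ℝ) :
    (tensorDeriv s p).totalDegree ≤ p.totalDegree - j := by
  induction j with
  | zero => simp [tensorDeriv]
  | succ n ih =>
    have h1 : tensorDeriv s p =
        MvPolynomial.pderiv (s 0) (tensorDeriv (fun i => s i.succ) p) := by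
      simp [tensorDeriv, List.ofFn_succ]
    rw [h1]
    exact (totalDegree_pderiv_le _ _).trans (by have := ih fun i => s i.succ; omega)

/-- Taking all but one of the `j` derivatives already leaves a constant. This restricts the inverse
estimate to `j ≤ k` and so makes its constant independent of `j`. -/
theorem tensorDeriv_eq_zero {j : ℕ} (hj : k < j) (s : Fin j → Fin d)
    {p : MvPolynomial (Fin d) ℝ} (hp : p ∈ MvPolynomial.restrictTotalDegree (Fin d) ℝ k) :
    tensorDeriv s p = 0 := by
  rw [MvPolynomial.mem_restrictTotalDegree] at hp
  obtain _ | n := j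
  · omega
  · have h1 : tensorDeriv s p =
        MvPolynomial.pderiv (s 0) (tensorDeriv (fun i => s i.succ) p) := by
      simp [tensorDeriv, List.ofFn_succ]
    have h2 := totalDegree_tensorDeriv_le (fun i => s i.succ) p
    have h3 : (tensorDeriv (fun i => s i.succ) p).totalDegree = 0 := by omega
    rw [h1, MvPolynomial.totalDegree_eq_zero_iff_eq_C.1 h3, MvPolynomial.pderiv_C]

end Polynomials

/-! ### Uniform comparison of quadratic forms over a compact parameter set -/

/-- Quadratic forms on a finite-dimensional space that depend continuously on a parameter in a
compact set are bounded by positive definite ones, uniformly in the parameter. -/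
theorem exists_uniform_quadratic_bound {Y V : Type*} [TopologicalSpace Y] [AddCommGroup V]
    [Module ℝ V] [Module.Finite ℝ V] {K : Set Y} (hK : IsCompact K)
    (f g : Y → LinearMap.BilinForm ℝ V)
    (hf : ∀ p q, ContinuousOn (fun B => f B p q) K)
    (hg : ∀ p q, ContinuousOn (fun B => g B p q) K)
    (hpos : ∀ B ∈ K, ∀ p, p ≠ 0 → 0 < g B p p) :
    ∃ C : ℝ, 0 < C ∧ ∀ B ∈ K, ∀ p, f B p p ≤ C * g B p p := by
  let e := Module.finBasis ℝ V
  let φ : (Fin (Module.finrank ℝ V) → ℝ) ≃ₗ[ℝ] V := e.equivFun.symm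
  have hcont : ∀ u : Y → LinearMap.BilinForm ℝ V,
      (∀ p q, ContinuousOn (fun B => u B p q) K) →
      ContinuousOn (fun z : Y × (Fin (Module.finrank ℝ V) → ℝ) => u z.1 (φ z.2) (φ z.2))
        (K ×ˢ Set.univ) := by
    intro u hu
    have : (fun z : Y × (Fin (Module.finrank ℝ V) → ℝ) => u z.1 (φ z.2) (φ z.2)) =
        fun z => ∑ i, ∑ j, z.2 i * (z.2 j * u z.1 (e j) (e i)) := by
      funext z
      simp [φ, Module.Basis.equivFun_symm_apply, LinearMap.sum_apply, Finset.mul_sum]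
    rw [this]
    refine continuousOn_finsetSum _ fun i _ => continuousOn_finsetSum _ fun j _ => ?_
    refine ContinuousOn.mul (by fun_prop) (ContinuousOn.mul (by fun_prop) ?_)
    exact (hu (e j) (e i)).comp continuousOn_fst fun z hz => hz.1
  have hcomp : IsCompact (K ×ˢ Metric.sphere (0 : Fin (Module.finrank ℝ V) → ℝ) 1) :=
    hK.prod (isCompact_sphere _ _)
  have hne : ∀ c ∈ Metric.sphere (0 : Fin (Module.finrank ℝ V) → ℝ) 1, φ c ≠ 0 := by
    intro c hc h0
    have : c = 0 := by simpa using h0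
    simp [this] at hc
  -- By homogeneity it suffices to bound the quotient of the two forms on `K` times the unit sphere
  -- of coordinates, where it is continuous on a compact set.
  obtain ⟨C, hC⟩ := hcomp.bddAbove_image
    (f := fun z : Y × (Fin (Module.finrank ℝ V) → ℝ) =>
      f z.1 (φ z.2) (φ z.2) / g z.1 (φ z.2) (φ z.2))
    (ContinuousOn.div ((hcont f hf).mono (Set.prod_mono_right (Set.subset_univ _)))
      ((hcont g hg).mono (Set.prod_mono_right (Set.subset_univ _)))
      fun z hz => (hpos z.1 hz.1 _ (hne z.2 hz.2)).ne')
  refine ⟨max C 1, by positivity, fun B hB p => ?_⟩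
  obtain ⟨c, rfl⟩ := φ.surjective p
  by_cases hc : c = 0
  · simp [hc]
  have hn : 0 < ‖c‖ := norm_pos_iff.2 hc
  set c' := ‖c‖⁻¹ • c with hc'
  have hcc : c = ‖c‖ • c' := by rw [hc', smul_smul, mul_inv_cancel₀ hn.ne', one_smul]
  have hc1 : c' ∈ Metric.sphere (0 : Fin (Module.finrank ℝ V) → ℝ) 1 := by
    simp [hc', norm_smul, hn.ne']
  have h1 : f B (φ c') (φ c') / g B (φ c') (φ c') ≤ C :=
    hC ⟨(B, c'), ⟨hB, hc1⟩, rfl⟩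
  have hp := hpos B hB _ (hne c' hc1)
  rw [div_le_iff₀ hp] at h1
  have h2 : f B (φ c') (φ c') ≤ max C 1 * g B (φ c') (φ c') :=
    h1.trans (by gcongr; exact le_max_left _ _)
  rw [hcc]
  simp only [map_smul, LinearMap.smul_apply, smul_eq_mul]
  nlinarith [mul_le_mul_of_nonneg_left h2 (mul_pos hn hn).le]

/-! ### Square integrals of polynomials -/

section IntSq

variable {d k : ℕ}

/-- The squared `L²` norm of a polynomial over a set. -/
def intSq (S : Set (Fin d → ℝ)) (p : MvPolynomial (Fin d) ℝ) : ℝ :=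
  ∫ y in S, (MvPolynomial.eval y p) ^ 2

theorem continuous_eval_poly (p : MvPolynomial (Fin d) ℝ) :
    Continuous fun y => MvPolynomial.eval y p := MvPolynomial.continuous_eval p

theorem integrableOn_sq_eval {S : Set (Fin d → ℝ)} (hS : IsCompact S)
    (p : MvPolynomial (Fin d) ℝ) : IntegrableOn (fun y => (MvPolynomial.eval y p) ^ 2) S :=
  ((continuous_eval_poly p).pow 2).continuousOn.integrableOn_compact hS

theorem intSq_nonneg (S : Set (Fin d → ℝ)) (p : MvPolynomial (Fin d) ℝ) : 0 ≤ intSq S p :=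
  integral_nonneg fun _ => sq_nonneg _

@[simp]
theorem intSq_zero (S : Set (Fin d → ℝ)) : intSq S (0 : MvPolynomial (Fin d) ℝ) = 0 := by
  simp [intSq]

/-- Pointwise `(a + b)² ≤ 2a² + 2b²`; a substitute for the triangle inequality that lets all
estimates be carried out on squared norms. -/
theorem intSq_add_le {S : Set (Fin d → ℝ)} (hS : IsCompact S) (p q : MvPolynomial (Fin d) ℝ) :
    intSq S (p + q) ≤ 2 * intSq S p + 2 * intSq S q := by
  simp only [intSq]
  rw [← integral_const_mul, ← integral_const_mul, ← integral_add
    ((integrableOn_sq_eval hS p).const_mul 2) ((integrableOn_sq_eval hS q).const_mul 2)]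
  refine integral_mono (integrableOn_sq_eval hS _)
    (((integrableOn_sq_eval hS p).const_mul 2).add ((integrableOn_sq_eval hS q).const_mul 2))
    fun y => ?_
  simp only [map_add]
  nlinarith [sq_nonneg (MvPolynomial.eval y p - MvPolynomial.eval y q)]

theorem intSq_neg (S : Set (Fin d → ℝ)) (p : MvPolynomial (Fin d) ℝ) :
    intSq S (-p) = intSq S p := by
  simp [intSq]

theorem intSq_sub_le {S : Set (Fin d → ℝ)} (hS : IsCompact S) (p q : MvPolynomial (Fin d) ℝ) :
    intSq S (p - q) ≤ 2 * intSq S p + 2 * intSq S q := by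
  rw [sub_eq_add_neg, ← intSq_neg S q]
  exact intSq_add_le hS _ _

theorem intSq_sum_smul_le {ι : Type*} {S : Set (Fin d → ℝ)} (hS : IsCompact S) (s : Finset ι)
    (c : ι → ℝ) (q : ι → MvPolynomial (Fin d) ℝ) :
    intSq S (∑ l ∈ s, c l • q l) ≤ (∑ l ∈ s, c l ^ 2) * ∑ l ∈ s, intSq S (q l) := by
  simp only [intSq]
  rw [← integral_finsetSum _ fun l _ => integrableOn_sq_eval hS (q l), ← integral_const_mul]
  refine integral_mono (integrableOn_sq_eval hS _)
    ((integrable_finsetSum _ fun l _ => integrableOn_sq_eval hS (q l)).const_mul _) fun y => ?_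
  simp only [map_sum, MvPolynomial.smul_eval]
  exact Finset.sum_mul_sq_le_sq_mul_sq s c _

theorem intSq_pos {S : Set (Fin d → ℝ)} (hS : IsCompact S) (hi : (interior S).Nonempty)
    {p : MvPolynomial (Fin d) ℝ} (hp : p ≠ 0) : 0 < intSq S p := by
  rw [intSq, setIntegral_pos_iff_support_of_nonneg_ae
    (Filter.Eventually.of_forall fun _ => sq_nonneg _) (integrableOn_sq_eval hS p)]
  have hopen : IsOpen (Function.support fun y => (MvPolynomial.eval y p) ^ 2) :=
    ((continuous_eval_poly p).pow 2).isOpen_support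
  have hne : (Function.support (fun y => (MvPolynomial.eval y p) ^ 2) ∩ interior S).Nonempty := by
    by_contra hcon
    refine hp ?_
    obtain ⟨x, hx⟩ := hi
    obtain ⟨ε, hε, hball⟩ := Metric.isOpen_iff.1 isOpen_interior x hx
    -- A ball in the sup norm is a product of intervals, hence of infinite sets, and a polynomial
    -- vanishing on such a product is zero.
    refine MvPolynomial.funext_set (fun i => Metric.ball (x i) ε) (fun i => ?_) fun y hy => ?_
    · rw [Real.ball_eq_Ioo]
      exact Set.Ioo_infinite (by linarith)
    · have hy' : y ∈ interior S := hball (by rwa [ball_pi x hε])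
      by_contra h0
      exact hcon ⟨y, by simpa using h0, hy'⟩
  exact ((hopen.inter isOpen_interior).measure_pos volume hne).trans_le
    (measure_mono (Set.inter_subset_inter_right _ interior_subset))

/-- The `L²` inner product of polynomials over a compact set. -/
def intForm {S : Set (Fin d → ℝ)} (hS : IsCompact S) :
    LinearMap.BilinForm ℝ (MvPolynomial (Fin d) ℝ) :=
  have hi : ∀ p q : MvPolynomial (Fin d) ℝ,
      IntegrableOn (fun y => MvPolynomial.eval y p * MvPolynomial.eval y q) S := fun p q =>
    ((continuous_eval_poly p).mul (continuous_eval_poly q)).continuousOn.integrableOn_compact hS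
  LinearMap.mk₂ ℝ (fun p q => ∫ y in S, MvPolynomial.eval y p * MvPolynomial.eval y q)
    (fun p p' q => by simp only [map_add, add_mul]; exact integral_add (hi p q) (hi p' q))
    (fun c p q => by simp only [MvPolynomial.smul_eval, mul_assoc]; exact integral_const_mul _ _)
    (fun p q q' => by simp only [map_add, mul_add]; exact integral_add (hi p q) (hi p q'))
    (fun c p q => by
      simp only [MvPolynomial.smul_eval, mul_left_comm _ c]; exact integral_const_mul _ _)

theorem intForm_self {S : Set (Fin d → ℝ)} (hS : IsCompact S) (p : MvPolynomial (Fin d) ℝ) :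
    intForm hS p p = intSq S p := by
  simp [intForm, intSq, pow_two]

/-- On polynomials of bounded degree, the first derivatives are bounded in `L²` over a compact set
with nonempty interior. -/
theorem exists_intSq_pderiv_le (k : ℕ) {S : Set (Fin d → ℝ)} (hS : IsCompact S)
    (hi : (interior S).Nonempty) :
    ∃ C : ℝ, 0 < C ∧ ∀ p ∈ MvPolynomial.restrictTotalDegree (Fin d) ℝ k,
      ∑ l, intSq S (MvPolynomial.pderiv l p) ≤ C * intSq S p := by
  let ι := (MvPolynomial.restrictTotalDegree (Fin d) ℝ k).subtype
  -- No parameter varies here: the compactness lemma over a one-point space is equivalence of norms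
  -- in finite dimension.
  obtain ⟨C, hC, h⟩ := exists_uniform_quadratic_bound (K := (Set.univ : Set Unit))
    (V := Pk d k) isCompact_univ
    (fun _ => ∑ l : Fin d, (intForm hS).comp ((MvPolynomial.pderiv l).toLinearMap ∘ₗ ι)
      ((MvPolynomial.pderiv l).toLinearMap ∘ₗ ι))
    (fun _ => (intForm hS).comp ι ι)
    (fun _ _ => continuousOn_const) (fun _ _ => continuousOn_const)
    (fun _ _ p hp => by
      simpa [ι, intForm_self] using intSq_pos hS hi (p := p.1) (by simpa using hp))
  refine ⟨C, hC, fun p hp => ?_⟩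
  simpa [ι, intForm_self, LinearMap.sum_apply] using h () trivial ⟨p, hp⟩

end IntSq

/-! ### Degrees of freedom in reference coordinates -/

section RefDof

variable {d k : ℕ}

/-- The degree of freedom of `x` in coordinates related to the reference coordinates by an affine
map with inverse linear part `G`. -/
def refDof (G : Matrix (Fin d) (Fin d) ℝ) (x : GenNode d) : MvPolynomial (Fin d) ℝ →ₗ[ℝ] ℝ :=
  (MvPolynomial.aeval x.pt).toLinearMap ∘ₗ pulledMultiDeriv G x.idx

/-- `∑ x, refDof x p ^ 2` as a quadratic form. -/
def refDofForm (X : Finset (GenNode d)) (G : Matrix (Fin d) (Fin d) ℝ) :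
    LinearMap.BilinForm ℝ (MvPolynomial (Fin d) ℝ) :=
  ∑ x ∈ X, LinearMap.BilinForm.linMulLin (refDof G x) (refDof G x)

theorem refDofForm_apply (X : Finset (GenNode d)) (G : Matrix (Fin d) (Fin d) ℝ)
    (p q : MvPolynomial (Fin d) ℝ) :
    refDofForm X G p q = ∑ x ∈ X, refDof G x p * refDof G x q := by
  simp [refDofForm, LinearMap.sum_apply]

/-- Cramer's rule: an entry of the inverse is a polynomial in the entries divided by the
determinant. -/
theorem continuousOn_inv_apply {K : Set (Matrix (Fin d) (Fin d) ℝ)}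
    (hK : ∀ B ∈ K, IsUnit B.det) (l i : Fin d) : ContinuousOn (fun B => B⁻¹ l i) K := by
  simp only [Matrix.inv_def, Ring.inverse_eq_inv', Matrix.smul_apply, smul_eq_mul]
  refine ContinuousOn.mul (ContinuousOn.inv₀ ?_ fun B hB => (hK B hB).ne_zero) ?_
  · exact (continuous_id.matrix_det).continuousOn
  · exact (continuous_id.matrix_adjugate.matrix_elem l i).continuousOn

/-- `V` carries no topology, so continuity of a `V`-valued map is tested against all linear
functionals. If each factor preserves this weak continuity, so does the product. -/
theorem continuousOn_list_prod_apply {Y V : Type*} [TopologicalSpace Y] [AddCommGroup V]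
    [Module ℝ V] {K : Set Y} {n : ℕ} {f : Fin n → Y → Module.End ℝ V}
    (hf : ∀ i, ∀ P : Y → V, (∀ L : V →ₗ[ℝ] ℝ, ContinuousOn (fun B => L (P B)) K) →
      ∀ L : V →ₗ[ℝ] ℝ, ContinuousOn (fun B => L (f i B (P B))) K)
    (P : Y → V) (hP : ∀ L : V →ₗ[ℝ] ℝ, ContinuousOn (fun B => L (P B)) K) :
    ∀ L : V →ₗ[ℝ] ℝ, ContinuousOn (fun B => L ((List.ofFn fun i => f i B).prod (P B))) K := by
  induction n with
  | zero => simpa using hP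
  | succ n ih =>
    simp only [List.ofFn_succ, List.prod_cons, Module.End.mul_apply]
    exact hf 0 _ (ih fun i => hf i.succ)

theorem continuousOn_pow_apply {Y V : Type*} [TopologicalSpace Y] [AddCommGroup V]
    [Module ℝ V] {K : Set Y} {f : Y → Module.End ℝ V}
    (hf : ∀ P : Y → V, (∀ L : V →ₗ[ℝ] ℝ, ContinuousOn (fun B => L (P B)) K) →
      ∀ L : V →ₗ[ℝ] ℝ, ContinuousOn (fun B => L (f B (P B))) K) (n : ℕ)
    (P : Y → V) (hP : ∀ L : V →ₗ[ℝ] ℝ, ContinuousOn (fun B => L (P B)) K) :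
    ∀ L : V →ₗ[ℝ] ℝ, ContinuousOn (fun B => L ((f B ^ n) (P B))) K := by
  induction n with
  | zero => simpa using hP
  | succ n ih =>
    simp only [pow_succ', Module.End.mul_apply]
    exact hf _ ih

theorem continuousOn_refDof_inv {K : Set (Matrix (Fin d) (Fin d) ℝ)}
    (hK : ∀ B ∈ K, IsUnit B.det) (x : GenNode d) (p : MvPolynomial (Fin d) ℝ) :
    ContinuousOn (fun B => refDof B⁻¹ x p) K := by
  refine continuousOn_list_prod_apply
    (f := fun i (B : Matrix (Fin d) (Fin d) ℝ) => pulledDeriv B⁻¹ i ^ x.idx i)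
    (fun i => continuousOn_pow_apply (fun P hP L => ?_) _) (fun _ => p)
    (fun _ => continuousOn_const) (MvPolynomial.aeval x.pt).toLinearMap
  -- Composing `L` with a partial derivative gives another functional, so weak continuity of `P`
  -- applies again; only the entries of `B⁻¹` add dependence on `B`.
  simp only [pulledDeriv, LinearMap.sum_apply, LinearMap.smul_apply, map_sum, map_smul,
    smul_eq_mul]
  exact continuousOn_finsetSum _ fun l _ => (continuousOn_inv_apply hK l i).mul
    (hP (L ∘ₗ (MvPolynomial.pderiv l).toLinearMap))

theorem continuousOn_refDofForm_inv {K : Set (Matrix (Fin d) (Fin d) ℝ)}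
    (hK : ∀ B ∈ K, IsUnit B.det) (X : Finset (GenNode d)) (p q : MvPolynomial (Fin d) ℝ) :
    ContinuousOn (fun B => refDofForm X B⁻¹ p q) K := by
  simp only [refDofForm_apply]
  exact continuousOn_finsetSum _ fun x _ =>
    (continuousOn_refDof_inv hK x p).mul (continuousOn_refDof_inv hK x q)

theorem inv_smul_matrix {B : Matrix (Fin d) (Fin d) ℝ} (hB : IsUnit B.det) {h : ℝ}
    (hh : 0 < h) : (h • B)⁻¹ = h⁻¹ • B⁻¹ := by
  refine Matrix.inv_eq_left_inv ?_
  rw [Matrix.smul_mul, Matrix.mul_smul, Matrix.nonsing_inv_mul B hB, smul_smul,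
    inv_mul_cancel₀ hh.ne', one_smul]

theorem isUnit_det_smul {B : Matrix (Fin d) (Fin d) ℝ} (hB : IsUnit B.det) {h : ℝ}
    (hh : 0 < h) : IsUnit (h • B).det := by
  rw [Matrix.det_smul]
  exact (hh.ne'.isUnit.pow _).mul hB

/-- The inverse linear part is `h⁻¹ • B⁻¹`, so `|α|` derivatives produce `h ^ (-|α|)`, which the
weight cancels. -/
theorem dof_smul_affineMap {B : Matrix (Fin d) (Fin d) ℝ} (hB : IsUnit B.det) {h : ℝ}
    (hh : 0 < h) (b : Fin d → ℝ) (x : GenNode d) (w : Pk d k) :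
    h ^ (∑ i, x.idx i) * dof ⟨x.idx, affineMap (h • B) b x.pt⟩ w =
      refDof B⁻¹ x (pullback (h • B) b w.1) := by
  rw [dof_affineMap (isUnit_det_smul hB hh), inv_smul_matrix hB hh,
    pulledMultiDeriv_smul, refDof]
  simp only [LinearMap.smul_apply, MvPolynomial.smul_eval, LinearMap.comp_apply,
    AlgHom.toLinearMap_apply, MvPolynomial.aeval_eq_eval]
  rw [← mul_assoc, ← mul_pow, mul_inv_cancel₀ hh.ne', one_pow, one_mul]

end RefDof

/-! ### Reference elements and their affine images -/

namespace RefElement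

variable {d k : ℕ} (E : RefElement d k)

/-- The reference polytope. -/
def hull : Set (Fin d → ℝ) := convexHull ℝ (E.vertices : Set (Fin d → ℝ))

theorem isCompact_hull : IsCompact E.hull := E.vertices.finite_toSet.isCompact_convexHull ℝ

end RefElement

section Affine

variable {d k : ℕ}

theorem affineMap_injective {A : Matrix (Fin d) (Fin d) ℝ} (hA : IsUnit A.det)
    (b : Fin d → ℝ) : Function.Injective (affineMap A b) := fun x y hxy => by
  have h1 : A.mulVec x = A.mulVec y := add_right_cancel hxy
  exact Matrix.mulVec_injective_of_isUnit ((Matrix.isUnit_iff_isUnit_det A).2 hA) h1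

theorem continuous_affineMap (A : Matrix (Fin d) (Fin d) ℝ) (b : Fin d → ℝ) :
    Continuous (affineMap A b) :=
  (continuous_const.matrix_mulVec continuous_id).add continuous_const

theorem hasFDerivAt_affineMap (A : Matrix (Fin d) (Fin d) ℝ) (b x : Fin d → ℝ) :
    HasFDerivAt (affineMap A b) (LinearMap.toContinuousLinearMap (Matrix.toLin' A)) x := by
  exact (LinearMap.toContinuousLinearMap (Matrix.toLin' A)).hasFDerivAt.add_const b

theorem intSq_image_affineMap {A : Matrix (Fin d) (Fin d) ℝ} (hA : IsUnit A.det)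
    (b : Fin d → ℝ) {S : Set (Fin d → ℝ)} (hS : IsCompact S) (p : MvPolynomial (Fin d) ℝ) :
    intSq (affineMap A b '' S) p = |A.det| * intSq S (pullback A b p) := by
  rw [intSq, integral_image_eq_integral_abs_det_fderiv_smul volume hS.measurableSet
    (fun x _ => (hasFDerivAt_affineMap A b x).hasFDerivWithinAt)
    (affineMap_injective hA b).injOn, intSq, ← integral_const_mul]
  simp [eval_pullback, ContinuousLinearMap.det]

theorem volume_image_affineMap (A : Matrix (Fin d) (Fin d) ℝ) (b : Fin d → ℝ)
    (S : Set (Fin d → ℝ)) :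
    volume (affineMap A b '' S) = ENNReal.ofReal |A.det| * volume S := by
  have h1 : affineMap A b '' S = (fun x => x + b) '' (Matrix.toLin' A '' S) := by
    rw [Set.image_image]
    rfl
  rw [h1, Set.image_add_right, measure_preimage_add_right, Measure.addHaar_image_linearMap,
    LinearMap.det_toLin']

theorem isOpen_image_affineMap {A : Matrix (Fin d) (Fin d) ℝ} (hA : IsUnit A.det)
    (b : Fin d → ℝ) {S : Set (Fin d → ℝ)} (hS : IsOpen S) : IsOpen (affineMap A b '' S) := by
  have h1 : affineMap A b '' S = (fun x => A⁻¹.mulVec (x - b)) ⁻¹' S := by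
    ext y
    constructor
    · rintro ⟨x, hx, rfl⟩
      simpa [affineMap, Matrix.mulVec_mulVec, Matrix.nonsing_inv_mul A hA] using hx
    · intro hy
      exact ⟨_, hy, by simp [affineMap, Matrix.mulVec_mulVec, Matrix.mul_nonsing_inv A hA]⟩
  rw [h1]
  exact hS.preimage (continuous_const.matrix_mulVec (continuous_id.sub continuous_const))

end Affine

/-! ### Uniform estimates on the elements of a family -/

namespace ElementFamily

variable {d k : ℕ} {ρ : Type} (F : ElementFamily d k ρ) (r : ρ)

/-- The determinants of the admissible shapes are bounded from above and from below. -/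
theorem exists_det_bounds : ∃ c C : ℝ, 0 < c ∧ 0 < C ∧
    ∀ B ∈ F.shapes r, c ≤ |B.det| ∧ |B.det| ≤ C := by
  have hcont : ContinuousOn (fun B : Matrix (Fin d) (Fin d) ℝ => |B.det|) (F.shapes r) :=
    (continuous_id.matrix_det).abs.continuousOn
  obtain ⟨C, hC⟩ := (F.shapes_compact r).bddAbove_image hcont
  obtain ⟨C', hC'⟩ := (F.shapes_compact r).bddAbove_image
    (hcont.inv₀ fun B hB => abs_ne_zero.2 (F.shapes_invertible r B hB).ne_zero)
  refine ⟨(max C' 1)⁻¹, max C 1, by positivity, by positivity, fun B hB => ⟨?_, ?_⟩⟩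
  · have h1 : |B.det|⁻¹ ≤ max C' 1 := (hC' ⟨B, hB, rfl⟩).trans (le_max_left _ _)
    have h2 : 0 < |B.det| := abs_pos.2 (F.shapes_invertible r B hB).ne_zero
    exact inv_le_of_inv_le₀ h2 h1
  · exact (hC ⟨B, hB, rfl⟩).trans (le_max_left _ _)

theorem exists_inv_bound : ∃ C : ℝ, 0 < C ∧
    ∀ B ∈ F.shapes r, ∀ i, ∑ l, (B⁻¹ l i) ^ 2 ≤ C := by
  obtain ⟨C, hC⟩ := (F.shapes_compact r).bddAbove_image
    (f := fun B : Matrix (Fin d) (Fin d) ℝ => ∑ i, ∑ l, (B⁻¹ l i) ^ 2)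
    (continuousOn_finsetSum _ fun i _ => continuousOn_finsetSum _ fun l _ =>
      (continuousOn_inv_apply (F.shapes_invertible r) l i).pow 2)
  refine ⟨max C 1, by positivity, fun B hB i => ?_⟩
  refine le_trans ?_ ((hC ⟨B, hB, rfl⟩).trans (le_max_left _ _))
  exact Finset.single_le_sum (f := fun i => ∑ l, (B⁻¹ l i) ^ 2)
    (fun i _ => Finset.sum_nonneg fun l _ => sq_nonneg _) (Finset.mem_univ i)

theorem exists_diam_bound : ∃ R : ℝ, 0 < R ∧
    ∀ B ∈ F.shapes r, ∀ x ∈ (F.ref r).hull, ∀ y ∈ (F.ref r).hull,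
      ‖B.mulVec (x - y)‖ ≤ R := by
  have hc := (F.ref r).isCompact_hull
  have hcomp := (F.shapes_compact r).prod (hc.prod hc)
  obtain ⟨C, hC⟩ := hcomp.bddAbove_image
    (f := fun z : Matrix (Fin d) (Fin d) ℝ × (Fin d → ℝ) × (Fin d → ℝ) =>
      ‖z.1.mulVec (z.2.1 - z.2.2)‖)
    (Continuous.continuousOn (continuous_norm.comp (Continuous.matrix_mulVec continuous_fst
      (by fun_prop))))
  refine ⟨max C 1, by positivity, fun B hB x hx y hy => ?_⟩
  exact (hC ⟨(B, x, y), ⟨hB, hx, hy⟩, rfl⟩).trans (le_max_left _ _)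

/-- The sum of the squared degrees of freedom is bounded by the squared `L²` norm. -/
theorem exists_dof_le : ∃ C : ℝ, 0 < C ∧ ∀ B ∈ F.shapes r,
    ∀ p ∈ MvPolynomial.restrictTotalDegree (Fin d) ℝ k,
      ∑ x ∈ (F.ref r).nodes, refDof B⁻¹ x p ^ 2 ≤ C * intSq (F.ref r).hull p := by
  let ι := (MvPolynomial.restrictTotalDegree (Fin d) ℝ k).subtype
  have hS := (F.ref r).isCompact_hull
  obtain ⟨C, hC, h⟩ := exists_uniform_quadratic_bound (V := Pk d k) (F.shapes_compact r)
    (fun B => (refDofForm (F.ref r).nodes B⁻¹).comp ι ι)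
    (fun _ => (intForm hS).comp ι ι)
    (fun p q => by
      simpa [ι] using continuousOn_refDofForm_inv (F.shapes_invertible r) (F.ref r).nodes p.1 q.1)
    (fun _ _ => continuousOn_const)
    (fun _ _ p hp => by
      simpa [ι, intForm_self] using
        intSq_pos hS (F.ref r).interior_nonempty (p := p.1) (by simpa using hp))
  refine ⟨C, hC, fun B hB p hp => ?_⟩
  simpa [ι, intForm_self, refDofForm_apply, ← pow_two] using h B hB ⟨p, hp⟩

/-- On the reference space, the degrees of freedom of an admissible shape determine a
polynomial. -/
theorem eq_zero_of_refDof_eq_zero {B : Matrix (Fin d) (Fin d) ℝ} (hB : B ∈ F.shapes r)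
    {p : Pk d k} (hp : p ∈ (F.ref r).space)
    (h0 : ∀ x ∈ (F.ref r).nodes, refDof B⁻¹ x p.1 = 0) : p = 0 := by
  have hdet := F.shapes_invertible r B hB
  -- Unisolvence is assumed only on physical elements, so `p` is moved to the one with `h = 1` and
  -- zero shift.
  let v : Pk d k := ⟨pullback B⁻¹ 0 p.1, pullback_mem_Pk _ _ p.2⟩
  have hpv : pullback ((1 : ℝ) • B) 0 v.1 = p.1 := by
    rw [one_smul]
    exact pullback_pullback_inv hdet p.1
  have hv : v ∈ (F.ref r).imageSpace ((1 : ℝ) • B) 0 :=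
    ⟨p, hp, by simpa using hpv.symm⟩
  have hspan := (F.unisolvent r B hB 1 one_pos 0).2
  have hdof : ∀ y ∈ (F.ref r).imageNodes ((1 : ℝ) • B) 0, dof y v = 0 := by
    intro y hy
    obtain ⟨x, hx, rfl⟩ := Finset.mem_image.1 hy
    have h1 := dof_smul_affineMap hdet one_pos 0 x v
    rw [hpv, h0 x hx] at h1
    simpa using h1
  have : Module.Free ℝ ((F.ref r).imageSpace ((1 : ℝ) • B) 0) :=
    Module.Free.of_divisionRing ℝ ((F.ref r).imageSpace ((1 : ℝ) • B) 0)
  -- The dual separates points and is spanned by functionals that vanish at `v`.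
  have hv0 : (⟨v, hv⟩ : (F.ref r).imageSpace ((1 : ℝ) • B) 0) = 0 := by
    rw [← Module.forall_dual_apply_eq_zero_iff ℝ]
    intro f
    have hf : f ∈ Submodule.span ℝ (Set.range
        fun x : (F.ref r).imageNodes ((1 : ℝ) • B) 0 => ((dof x.1).domRestrict
          ((F.ref r).imageSpace ((1 : ℝ) • B) 0) : Module.Dual ℝ _)) := by
      rw [hspan]; trivial
    induction hf using Submodule.span_induction with
    | mem f hf => obtain ⟨x, rfl⟩ := hf; exact hdof x.1 x.2
    | zero => rfl
    | add f g _ _ hf hg => rw [LinearMap.add_apply, hf, hg, add_zero]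
    | smul c f _ hf => rw [LinearMap.smul_apply, hf, smul_zero]
  have hv1 : v = 0 := congrArg Subtype.val hv0
  rw [hv1] at hpv
  exact Subtype.ext (by simpa using hpv.symm)

/-- On the reference space, the squared `L²` norm is bounded by the sum of the squared degrees of
freedom of an admissible shape. -/
theorem exists_le_dof : ∃ C : ℝ, 0 < C ∧ ∀ B ∈ F.shapes r, ∀ p ∈ (F.ref r).space,
    intSq (F.ref r).hull p.1 ≤ C * ∑ x ∈ (F.ref r).nodes, refDof B⁻¹ x p.1 ^ 2 := by
  let ι := (MvPolynomial.restrictTotalDegree (Fin d) ℝ k).subtype ∘ₗ (F.ref r).space.subtype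
  have hS := (F.ref r).isCompact_hull
  have : Module.Finite ℝ (F.ref r).space :=
    Module.Finite.of_injective (F.ref r).space.subtype (F.ref r).space.injective_subtype
  obtain ⟨C, hC, h⟩ := exists_uniform_quadratic_bound (V := (F.ref r).space) (F.shapes_compact r)
    (fun _ => (intForm hS).comp ι ι)
    (fun B => (refDofForm (F.ref r).nodes B⁻¹).comp ι ι)
    (fun _ _ => continuousOn_const)
    (fun p q => by
      simpa [ι] using
        continuousOn_refDofForm_inv (F.shapes_invertible r) (F.ref r).nodes p.1.1 q.1.1)
    (fun B hB p hp => by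
      have hsum : 0 < ∑ x ∈ (F.ref r).nodes, refDof B⁻¹ x p.1.1 ^ 2 := by
        refine lt_of_le_of_ne (Finset.sum_nonneg fun x _ => sq_nonneg _) fun h0 => hp ?_
        refine Subtype.ext (F.eq_zero_of_refDof_eq_zero r hB p.2 fun x hx => ?_)
        simpa using (Finset.sum_eq_zero_iff_of_nonneg fun x _ => sq_nonneg _).1 h0.symm x hx
      simpa [ι, refDofForm_apply, ← pow_two] using hsum)
  refine ⟨C, hC, fun B hB p hp => ?_⟩
  simpa [ι, intForm_self, refDofForm_apply, ← pow_two] using h B hB ⟨p, hp⟩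

end ElementFamily

/-! ### Scaled estimates on physical elements -/

section CellEstimates

variable {d k : ℕ} {ρ : Type} {F : ElementFamily d k ρ}

namespace Cell

variable {h : ℝ} (T : Cell F)

theorem isUnit_det : IsUnit T.shape.det := F.shapes_invertible _ _ T.shape_mem

theorem carrier_eq (h : ℝ) :
    T.carrier h = affineMap (h • T.shape) T.shift '' (F.ref T.type).hull := rfl

theorem isCompact_carrier (h : ℝ) : IsCompact (T.carrier h) :=
  (F.ref T.type).isCompact_hull.image (continuous_affineMap _ _)

theorem intSq_carrier (hh : 0 < h) (p : MvPolynomial (Fin d) ℝ) :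
    intSq (T.carrier h) p = h ^ d * |T.shape.det| *
      intSq (F.ref T.type).hull (pullback (h • T.shape) T.shift p) := by
  rw [carrier_eq, intSq_image_affineMap (isUnit_det_smul T.isUnit_det hh) _
    (F.ref T.type).isCompact_hull, Matrix.det_smul, abs_mul, abs_of_pos (by positivity),
    Fintype.card_fin]

/-- The scaled squared degrees of freedom of an element, in reference coordinates. -/
theorem sum_nodes_dof_sq (hh : 0 < h) (w : Pk d k) :
    ∑ x ∈ T.nodes h, (h ^ (∑ i, x.idx i) * dof x w) ^ 2 =
      ∑ x ∈ (F.ref T.type).nodes,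
        refDof T.shape⁻¹ x (pullback (h • T.shape) T.shift w.1) ^ 2 := by
  rw [nodes, RefElement.imageNodes, Finset.sum_image]
  · exact Finset.sum_congr rfl fun x _ => by
      rw [← dof_smul_affineMap T.isUnit_det hh T.shift x w]
  · rintro ⟨α, y⟩ _ ⟨β, z⟩ _ hxy
    simp only [GenNode.mk.injEq] at hxy ⊢
    exact ⟨hxy.1, affineMap_injective (isUnit_det_smul T.isUnit_det hh) _ hxy.2⟩

end Cell

/-- Finitely many types allow passing to the largest of their constants. -/
theorem exists_bound_of_type [Finite ρ] {P : ρ → ℝ → Prop}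
    (hmono : ∀ r C C', C ≤ C' → P r C → P r C') (h : ∀ r, ∃ C, 0 < C ∧ P r C) :
    ∃ C : ℝ, 0 < C ∧ ∀ r, P r C := by
  choose C hC hP using h
  obtain ⟨M, hM⟩ := Finite.exists_le C
  exact ⟨max M 1, by positivity, fun r => hmono r _ _ ((hM r).trans (le_max_left _ _)) (hP r)⟩

variable [Finite ρ] (F)

/-- Inverse estimate for the first derivatives. -/
theorem exists_inverse_estimate : ∃ C : ℝ, 0 < C ∧ ∀ h : ℝ, 0 < h → ∀ T : Cell F,
    ∀ p ∈ MvPolynomial.restrictTotalDegree (Fin d) ℝ k, ∀ i,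
      h ^ 2 * intSq (T.carrier h) (MvPolynomial.pderiv i p) ≤ C * intSq (T.carrier h) p := by
  obtain ⟨C, hC, hP⟩ := exists_bound_of_type
    (P := fun r C => ∀ h : ℝ, 0 < h → ∀ T : Cell F, T.type = r →
      ∀ p ∈ MvPolynomial.restrictTotalDegree (Fin d) ℝ k, ∀ i,
      h ^ 2 * intSq (T.carrier h) (MvPolynomial.pderiv i p) ≤ C * intSq (T.carrier h) p)
    (fun r C C' hCC H h hh T hT p hp i => (H h hh T hT p hp i).trans
      (mul_le_mul_of_nonneg_right hCC (intSq_nonneg _ _))) (fun r => by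
    have hS := (F.ref r).isCompact_hull
    obtain ⟨C₁, hC₁, H₁⟩ := exists_intSq_pderiv_le k hS (F.ref r).interior_nonempty
    obtain ⟨C₂, hC₂, H₂⟩ := F.exists_inv_bound r
    refine ⟨C₂ * C₁, by positivity, ?_⟩
    rintro h hh T rfl p hp i
    have hq := H₁ _ (pullback_mem_Pk (h • T.shape) T.shift hp)
    have hB := H₂ _ T.shape_mem i
    rw [T.intSq_carrier hh, T.intSq_carrier hh,
      pullback_pderiv (isUnit_det_smul T.isUnit_det hh), inv_smul_matrix T.isUnit_det hh]
    set q := pullback (h • T.shape) T.shift p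
    have h1 : pulledDeriv (h⁻¹ • T.shape⁻¹) i q =
        ∑ l, (h⁻¹ * T.shape⁻¹ l i) • MvPolynomial.pderiv l q := by
      simp [pulledDeriv, LinearMap.sum_apply]
    have h2 : ∑ l, (h⁻¹ * T.shape⁻¹ l i) ^ 2 = (h ^ 2)⁻¹ * ∑ l, (T.shape⁻¹ l i) ^ 2 := by
      rw [Finset.mul_sum]
      exact Finset.sum_congr rfl fun l _ => by rw [mul_pow, inv_pow]
    have h3 : h ^ 2 * intSq (F.ref T.type).hull (pulledDeriv (h⁻¹ • T.shape⁻¹) i q) ≤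
        C₂ * C₁ * intSq (F.ref T.type).hull q := by
      have h4 := intSq_sum_smul_le hS Finset.univ (fun l => h⁻¹ * T.shape⁻¹ l i)
        fun l => MvPolynomial.pderiv l q
      rw [h2] at h4
      rw [h1]
      calc _ ≤ h ^ 2 * ((h ^ 2)⁻¹ * (∑ l, (T.shape⁻¹ l i) ^ 2) *
              ∑ l, intSq (F.ref T.type).hull (MvPolynomial.pderiv l q)) := by gcongr
        _ = (∑ l, (T.shape⁻¹ l i) ^ 2) *
              ∑ l, intSq (F.ref T.type).hull (MvPolynomial.pderiv l q) := by
            field_simp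
        _ ≤ C₂ * (C₁ * intSq (F.ref T.type).hull q) :=
            mul_le_mul hB hq (Finset.sum_nonneg fun l _ => intSq_nonneg _ _) hC₂.le
        _ = _ := by ring
    have h5 : 0 ≤ h ^ d * |T.shape.det| := by positivity
    calc _ = h ^ d * |T.shape.det| *
          (h ^ 2 * intSq (F.ref T.type).hull (pulledDeriv (h⁻¹ • T.shape⁻¹) i q)) := by ring
      _ ≤ h ^ d * |T.shape.det| * (C₂ * C₁ * intSq (F.ref T.type).hull q) := by gcongr
      _ = _ := by ring)
  exact ⟨C, hC, fun h hh T => hP T.type h hh T rfl⟩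

/-- The scaled degrees of freedom of an element are bounded by the `L²` norm. -/
theorem exists_dof_estimate : ∃ C : ℝ, 0 < C ∧ ∀ h : ℝ, 0 < h → ∀ T : Cell F, ∀ w : Pk d k,
    ∀ x ∈ T.nodes h, h ^ d * (h ^ (∑ i, x.idx i) * dof x w) ^ 2 ≤
      C * intSq (T.carrier h) w.1 := by
  obtain ⟨C, hC, hP⟩ := exists_bound_of_type
    (P := fun r C => ∀ h : ℝ, 0 < h → ∀ T : Cell F, T.type = r → ∀ w : Pk d k,
      ∀ x ∈ T.nodes h, h ^ d * (h ^ (∑ i, x.idx i) * dof x w) ^ 2 ≤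
      C * intSq (T.carrier h) w.1)
    (fun r C C' hCC H h hh T hT w x hx => (H h hh T hT w x hx).trans
      (mul_le_mul_of_nonneg_right hCC (intSq_nonneg _ _))) (fun r => by
    obtain ⟨c, _, hc, _, Hc⟩ := F.exists_det_bounds r
    obtain ⟨C, hC, H⟩ := F.exists_dof_le r
    refine ⟨c⁻¹ * C, by positivity, ?_⟩
    rintro h hh T rfl w x hx
    have h1 := H _ T.shape_mem _ (pullback_mem_Pk (h • T.shape) T.shift w.2)
    rw [← T.sum_nodes_dof_sq hh] at h1
    have h2 := (Finset.single_le_sum (f := fun x => (h ^ (∑ i, x.idx i) * dof x w) ^ 2)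
      (fun x _ => sq_nonneg _) hx).trans h1
    have h3 : 1 ≤ c⁻¹ * |T.shape.det| := by
      rw [← inv_mul_cancel₀ hc.ne']
      exact mul_le_mul_of_nonneg_left (Hc _ T.shape_mem).1 (by positivity)
    rw [T.intSq_carrier hh]
    set I := intSq (F.ref T.type).hull (pullback (h • T.shape) T.shift w.1)
    have hI : 0 ≤ I := intSq_nonneg _ _
    calc _ ≤ h ^ d * (C * I) := by gcongr
      _ ≤ (c⁻¹ * |T.shape.det|) * (h ^ d * (C * I)) := le_mul_of_one_le_left (by positivity) h3
      _ = _ := by ring)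
  exact ⟨C, hC, fun h hh T => hP T.type h hh T rfl⟩

/-- On the element space, the `L²` norm is bounded by the scaled degrees of freedom. -/
theorem exists_space_estimate : ∃ C : ℝ, 0 < C ∧ ∀ h : ℝ, 0 < h → ∀ T : Cell F,
    ∀ v ∈ T.space h, intSq (T.carrier h) v.1 ≤
      C * ∑ x ∈ T.nodes h, h ^ d * (h ^ (∑ i, x.idx i) * dof x v) ^ 2 := by
  obtain ⟨C, hC, hP⟩ := exists_bound_of_type
    (P := fun r C => ∀ h : ℝ, 0 < h → ∀ T : Cell F, T.type = r →
      ∀ v ∈ T.space h, intSq (T.carrier h) v.1 ≤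
      C * ∑ x ∈ T.nodes h, h ^ d * (h ^ (∑ i, x.idx i) * dof x v) ^ 2)
    (fun r C C' hCC H h hh T hT v hv => (H h hh T hT v hv).trans
      (mul_le_mul_of_nonneg_right hCC (Finset.sum_nonneg fun x _ => by positivity)))
    (fun r => by
    obtain ⟨_, D, _, hD, HD⟩ := F.exists_det_bounds r
    obtain ⟨C, hC, H⟩ := F.exists_le_dof r
    refine ⟨D * C, by positivity, ?_⟩
    rintro h hh T rfl v ⟨p, hp, hpv⟩
    have h1 := H _ T.shape_mem p hp
    have hpv' : p.1 = pullback (h • T.shape) T.shift v.1 := hpv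
    rw [hpv', ← T.sum_nodes_dof_sq hh] at h1
    rw [T.intSq_carrier hh, ← Finset.mul_sum]
    have h2 := (HD _ T.shape_mem).2
    have h3 := intSq_nonneg (F.ref T.type).hull (pullback (h • T.shape) T.shift v.1)
    calc _ = h ^ d * (|T.shape.det| * intSq (F.ref T.type).hull
          (pullback (h • T.shape) T.shift v.1)) := by ring
      _ ≤ h ^ d * (D * (C * ∑ x ∈ T.nodes h, (h ^ (∑ i, x.idx i) * dof x v) ^ 2)) := by
          gcongr
      _ = _ := by ring)
  exact ⟨C, hC, fun h hh T => hP T.type h hh T rfl⟩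

theorem exists_card_nodes_bound : ∃ m : ℕ, ∀ (h : ℝ) (T : Cell F), (T.nodes h).card ≤ m := by
  obtain ⟨m, hm⟩ := Finite.exists_le fun r => (F.ref r).nodes.card
  exact ⟨m, fun h T => Finset.card_image_le.trans (hm T.type)⟩

/-- The volume of the interior of an element of size `h` is at least of order `h ^ d`. -/
theorem exists_volume_bound : ∃ C : ℝ, 0 < C ∧ ∀ h : ℝ, 0 < h → ∀ T : Cell F,
    ENNReal.ofReal (h ^ d) ≤ ENNReal.ofReal C * volume (interior (T.carrier h)) := by
  obtain ⟨C, hC, hP⟩ := exists_bound_of_type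
    (P := fun r C => ∀ h : ℝ, 0 < h → ∀ T : Cell F, T.type = r →
      ENNReal.ofReal (h ^ d) ≤ ENNReal.ofReal C * volume (interior (T.carrier h)))
    (fun r C C' hCC H h hh T hT => (H h hh T hT).trans (by gcongr)) (fun r => by
    obtain ⟨c, _, hc, _, Hc⟩ := F.exists_det_bounds r
    have hvpos : 0 < volume (interior (F.ref r).hull) :=
      isOpen_interior.measure_pos volume (F.ref r).interior_nonempty
    have hvfin : volume (interior (F.ref r).hull) ≠ ⊤ :=
      ((measure_mono interior_subset).trans_lt (F.ref r).isCompact_hull.measure_lt_top).ne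
    have hv := ENNReal.toReal_pos hvpos.ne' hvfin
    refine ⟨(c * (volume (interior (F.ref r).hull)).toReal)⁻¹, by positivity, ?_⟩
    rintro h hh T rfl
    -- An invertible affine map is open, so the image of the reference interior lies in the interior
    -- of the element.
    have h1 : affineMap (h • T.shape) T.shift '' interior (F.ref T.type).hull ⊆
        interior (T.carrier h) :=
      interior_maximal (Set.image_mono interior_subset)
        (isOpen_image_affineMap (isUnit_det_smul T.isUnit_det hh) _ isOpen_interior)
    refine le_trans ?_ (mul_le_mul_right (measure_mono h1) _)
    rw [volume_image_affineMap, Matrix.det_smul, Fintype.card_fin, abs_mul,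
      abs_of_pos (pow_pos hh d), ← ENNReal.ofReal_toReal hvfin,
      ← ENNReal.ofReal_mul (by positivity), ← ENNReal.ofReal_mul (by positivity)]
    refine ENNReal.ofReal_le_ofReal ?_
    rw [ENNReal.toReal_ofReal hv.le]
    set V := (volume (interior (F.ref T.type).hull)).toReal
    have h2 := (Hc _ T.shape_mem).1
    rw [← div_eq_inv_mul, le_div_iff₀ (by positivity)]
    calc h ^ d * (c * V) ≤ h ^ d * (|T.shape.det| * V) := by gcongr
      _ = _ := by ring)
  exact ⟨C, hC, fun h hh T => hP T.type h hh T rfl⟩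

/-- The diameter of an element of size `h` is at most of order `h`. -/
theorem exists_diam_estimate : ∃ R : ℝ, 0 < R ∧ ∀ h : ℝ, 0 < h → ∀ T : Cell F,
    ∀ y ∈ T.carrier h, T.carrier h ⊆ Metric.closedBall y (R * h) := by
  obtain ⟨C, hC, hP⟩ := exists_bound_of_type
    (P := fun r R => ∀ h : ℝ, 0 < h → ∀ T : Cell F, T.type = r →
      ∀ y ∈ T.carrier h, T.carrier h ⊆ Metric.closedBall y (R * h))
    (fun r C C' hCC H h hh T hT y hy => (H h hh T hT y hy).trans
      (Metric.closedBall_subset_closedBall (by gcongr))) (fun r => by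
    obtain ⟨R, hR, H⟩ := F.exists_diam_bound r
    refine ⟨R, hR, ?_⟩
    rintro h hh T rfl _ ⟨y, hy, rfl⟩ _ ⟨z, hz, rfl⟩
    have h1 : affineMap (h • T.shape) T.shift z - affineMap (h • T.shape) T.shift y =
        h • T.shape.mulVec (z - y) := by
      simp [affineMap, Matrix.mulVec_sub, Matrix.smul_mulVec, smul_sub]
    rw [Metric.mem_closedBall, dist_eq_norm, h1, norm_smul, Real.norm_of_nonneg hh.le, mul_comm]
    exact mul_le_mul_of_nonneg_right (H _ T.shape_mem z hz y hy) hh.le)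
  exact ⟨C, hC, fun h hh T => hP T.type h hh T rfl⟩

/-- The number of elements of a mesh that contain a given point is bounded. -/
theorem exists_overlap_bound : ∃ N : ℕ, ∀ h : ℝ, 0 < h → ∀ (M : Mesh F h) [Fintype M.cells]
    (x : GenNode d), (M.cellsAt x).card ≤ N := by
  obtain ⟨C, hC, HC⟩ := exists_volume_bound F
  obtain ⟨R, hR, HR⟩ := exists_diam_estimate F
  -- A sup-norm ball of radius `R * h` has volume `(2 * R * h) ^ d`, and each element uses at least
  -- `h ^ d / C` of it.
  obtain ⟨N, hN⟩ := exists_nat_ge (C * (2 * R) ^ d)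
  refine ⟨N, fun h hh M _ x => ?_⟩
  have hdisj : Set.PairwiseDisjoint (M.cellsAt x : Set M.cells)
      fun T => interior (T.1.carrier h) := fun T _ T' _ hTT' =>
    M.disjoint_interiors T.1 T.2 T'.1 T'.2 fun h0 => hTT' (Subtype.ext h0)
  have hsub : (⋃ T ∈ M.cellsAt x, interior (T.1.carrier h)) ⊆
      Metric.closedBall x.pt (R * h) := by
    refine Set.iUnion₂_subset fun T hT => interior_subset.trans (HR h hh T.1 x.pt ?_)
    exact (Finset.mem_filter.1 hT).2
  have h1 := measure_mono (μ := volume) hsub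
  rw [measure_biUnion_finset hdisj fun T _ => isOpen_interior.measurableSet,
    Real.volume_pi_closedBall _ (by positivity), Fintype.card_fin] at h1
  have h2 : ∑ T ∈ M.cellsAt x, ENNReal.ofReal (h ^ d) ≤
      ENNReal.ofReal C * ENNReal.ofReal ((2 * (R * h)) ^ d) := by
    refine le_trans (Finset.sum_le_sum fun T _ => HC h hh T.1) ?_
    rw [← Finset.mul_sum]
    exact mul_le_mul_right h1 _
  rw [Finset.sum_const, nsmul_eq_mul, ← ENNReal.ofReal_natCast,
    ← ENNReal.ofReal_mul (by positivity),
    ← ENNReal.ofReal_mul (by positivity), ENNReal.ofReal_le_ofReal_iff (by positivity),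
    ← mul_assoc, mul_pow, ← mul_assoc] at h2
  have h3 := le_of_mul_le_mul_right h2 (pow_pos hh d)
  exact_mod_cast h3.trans hN

end CellEstimates

/-! ### The nodal averaging operator -/

namespace Mesh

variable {d k : ℕ} {ρ : Type} {F : ElementFamily d k ρ} {h : ℝ} (M : Mesh F h)
  [Fintype M.cells]

variable {M} in
-- This is where the mesh compatibility condition `nodes_shared` enters.
theorem mem_cellNodes {x : GenNode d} (hx : x ∈ M.nodes) {T : M.cells} (hT : T ∈ M.cellsAt x) :
    x ∈ T.1.nodes h := by
  obtain ⟨T₀, -, hx₀⟩ := Finset.mem_biUnion.1 hx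
  exact M.nodes_shared T₀.1 T₀.2 T.1 T.2 x hx₀ (Finset.mem_filter.1 hT).2

variable {M} in
theorem mem_nodes {x : GenNode d} {T : M.cells} (hx : x ∈ T.1.nodes h) : x ∈ M.nodes :=
  Finset.mem_biUnion.2 ⟨T, Finset.mem_univ _, hx⟩

variable {M} in
theorem mem_cellsAt {x : GenNode d} {T : M.cells} (hx : x ∈ T.1.nodes h) : T ∈ M.cellsAt x := by
  refine Finset.mem_filter.2 ⟨Finset.mem_univ _, ?_⟩
  obtain ⟨y, hy, rfl⟩ := Finset.mem_image.1 hx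
  exact ⟨y.pt, (F.ref T.1.type).nodes_mem y hy, rfl⟩

theorem isDualBasis (hh : 0 < h) (T : Cell F) : IsDualBasis (T.space h) (T.nodes h) :=
  F.unisolvent T.type T.shape T.shape_mem h hh T.shift

/-- If `T` contains the point of `y`, both nodes belong to `T` and local duality applies. Otherwise
the basis function vanishes on `T`, and `x ≠ y` because `T` contains the point of `x`. -/
theorem dof_basisFun (hh : 0 < h) {x y : GenNode d} (hx : x ∈ M.nodes) (hy : y ∈ M.nodes)
    {T : M.cells} (hT : T ∈ M.cellsAt x) :
    dof x (M.basisFun y T) = if x = y then 1 else 0 := by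
  by_cases hTy : T ∈ M.cellsAt y
  · rw [basisFun, if_pos hTy]
    exact (lagrangeBasis_spec (isDualBasis hh T.1) (mem_cellNodes hy hTy)).2 x
      (mem_cellNodes hx hT)
  · have hxy : x ≠ y := fun h0 => hTy (h0 ▸ hT)
    rw [basisFun, if_neg hTy, if_neg hxy, map_zero]

theorem basisFun_mem_space (hh : 0 < h) {y : GenNode d} (hy : y ∈ M.nodes) (T : M.cells) :
    M.basisFun y T ∈ T.1.space h := by
  by_cases hTy : T ∈ M.cellsAt y
  · rw [basisFun, if_pos hTy]
    exact (lagrangeBasis_spec (isDualBasis hh T.1) (mem_cellNodes hy hTy)).1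
  · rw [basisFun, if_neg hTy]
    exact zero_mem _

variable (κ : M.cells → GenNode d → ℝ)

theorem isLinearMap_average : IsLinearMap ℝ (M.average κ) where
  map_add v w := by
    simp [average, nodalAverage, mul_add, Finset.sum_add_distrib, add_smul]
  map_smul c w := by
    simp only [average, nodalAverage, Pi.smul_apply, map_smul, smul_eq_mul, mul_left_comm _ c,
      ← Finset.mul_sum, mul_smul, ← Finset.smul_sum]

theorem average_mem_Vh (w : M.Wh) : M.average κ w ∈ M.Vh :=
  Submodule.sum_mem _ fun x hx =>
    Submodule.smul_mem _ _ (Submodule.subset_span ⟨x, hx, rfl⟩)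

variable {κ}

theorem average_basisFun (hh : 0 < h) (hκ : M.IsWeight κ) {y : GenNode d} (hy : y ∈ M.nodes) :
    M.average κ (M.basisFun y) = M.basisFun y := by
  have h1 : ∀ x ∈ M.nodes, M.nodalAverage κ (M.basisFun y) x = if x = y then 1 else 0 := by
    intro x hx
    rw [nodalAverage, Finset.sum_congr rfl fun T hT => by
      rw [M.dof_basisFun hh hx hy hT], ← Finset.sum_mul, (hκ x hx).2, one_mul]
  rw [average, Finset.sum_congr rfl fun x hx => by rw [h1 x hx]]
  simp [ite_smul, hy]

/-- The nodal averaging operator is a projection onto `V_h`. -/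
theorem average_eq_self (hh : 0 < h) (hκ : M.IsWeight κ) {v : M.Wh} (hv : v ∈ M.Vh) :
    M.average κ v = v := by
  have hlin := M.isLinearMap_average κ
  induction hv using Submodule.span_induction with
  | mem v hv => obtain ⟨y, hy, rfl⟩ := hv; exact M.average_basisFun hh hκ hy
  | zero => exact hlin.map_zero
  | add v w _ _ hv hw => rw [hlin.map_add, hv, hw]
  | smul c v _ hv => rw [hlin.map_smul, hv]

theorem average_apply (w : M.Wh) (T : M.cells) :
    M.average κ w T = ∑ x ∈ M.nodes, M.nodalAverage κ w x • M.basisFun x T := by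
  simp [average, Finset.sum_apply]

theorem average_apply_mem_space (hh : 0 < h) (w : M.Wh) (T : M.cells) :
    M.average κ w T ∈ T.1.space h := by
  rw [average_apply]
  exact Submodule.sum_mem _ fun x hx =>
    Submodule.smul_mem _ _ (M.basisFun_mem_space hh hx T)

/-- The value does not depend on which element having `x` as a node is used: averaging makes the
degrees of freedom single-valued. -/
theorem dof_average (hh : 0 < h) (w : M.Wh) {T : M.cells} {x : GenNode d}
    (hx : x ∈ T.1.nodes h) : dof x (M.average κ w T) = M.nodalAverage κ w x := by
  have hxM := mem_nodes hx
  rw [average_apply, map_sum, Finset.sum_congr rfl fun y hy => by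
    rw [map_smul, M.dof_basisFun hh hxM hy (mem_cellsAt hx)]]
  simp [hxM]

/-- Cauchy–Schwarz, together with `∑ κ² ≤ ∑ κ = 1` because `0 ≤ κ ≤ 1`. No other property of the
weights affects the constant. -/
theorem nodalAverage_sq_le (hκ : M.IsWeight κ) (w : M.Wh) {x : GenNode d} (hx : x ∈ M.nodes) :
    M.nodalAverage κ w x ^ 2 ≤ ∑ T ∈ M.cellsAt x, dof x (w T) ^ 2 := by
  obtain ⟨h0, h1⟩ := hκ x hx
  have h2 : ∑ T ∈ M.cellsAt x, κ T x ^ 2 ≤ 1 := by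
    rw [← h1]
    refine Finset.sum_le_sum fun T hT => ?_
    have h3 : κ T x ≤ 1 := h1 ▸ Finset.single_le_sum (f := fun T => κ T x) h0 hT
    nlinarith [h0 T hT]
  exact (Finset.sum_mul_sq_le_sq_mul_sq _ _ _).trans
    (mul_le_of_le_one_left (Finset.sum_nonneg fun _ _ => sq_nonneg _) h2)

/-- The square of `l2norm`. -/
def l2sq (w : M.Wh) : ℝ := ∑ T : M.cells, intSq (T.1.carrier h) (w T).1

/-- The square of `gradNorm`. -/
def gradSq (j : ℕ) (w : M.Wh) : ℝ :=
  ∑ T : M.cells, ∑ s : Fin j → Fin d, intSq (T.1.carrier h) (tensorDeriv s (w T).1)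

theorem l2sq_nonneg (w : M.Wh) : 0 ≤ M.l2sq w :=
  Finset.sum_nonneg fun _ _ => intSq_nonneg _ _

theorem gradSq_nonneg (j : ℕ) (w : M.Wh) : 0 ≤ M.gradSq j w :=
  Finset.sum_nonneg fun _ _ => Finset.sum_nonneg fun _ _ => intSq_nonneg _ _

theorem l2norm_eq (w : M.Wh) : M.l2norm w = √(M.l2sq w) := rfl

theorem gradNorm_eq (j : ℕ) (w : M.Wh) : M.gradNorm j w = √(M.gradSq j w) := by
  rw [gradNorm, gradSq]
  congr 1
  refine Finset.sum_congr rfl fun T _ => ?_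
  exact integral_finsetSum _ fun s _ => integrableOn_sq_eval (T.1.isCompact_carrier h) _

theorem l2sq_sub_le (v w : M.Wh) : M.l2sq (v - w) ≤ 2 * M.l2sq v + 2 * M.l2sq w := by
  simp only [l2sq, Finset.mul_sum, ← Finset.sum_add_distrib]
  exact Finset.sum_le_sum fun T _ => intSq_sub_le (T.1.isCompact_carrier h) _ _

theorem gradSq_add_le (j : ℕ) (v w : M.Wh) :
    M.gradSq j (v + w) ≤ 2 * M.gradSq j v + 2 * M.gradSq j w := by
  simp only [gradSq, Finset.mul_sum, ← Finset.sum_add_distrib]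
  refine Finset.sum_le_sum fun T _ => Finset.sum_le_sum fun s _ => ?_
  have h1 : tensorDeriv s ((v + w) T).1 = tensorDeriv s (v T).1 + tensorDeriv s (w T).1 := by
    simp
  rw [h1]
  exact intSq_add_le (T.1.isCompact_carrier h) _ _

end Mesh

section Stability

variable {d k : ℕ} {ρ : Type} [Finite ρ] (F : ElementFamily d k ρ)

/-- Stability of the nodal averaging operator in `L²`. -/
theorem exists_l2sq_average_le : ∃ C : ℝ, 0 < C ∧ ∀ h : ℝ, 0 < h → ∀ (M : Mesh F h)
    [Fintype M.cells] (κ : M.cells → GenNode d → ℝ), M.IsWeight κ →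
    ∀ w, M.l2sq (M.average κ w) ≤ C * M.l2sq w := by
  obtain ⟨C₁, hC₁, H₁⟩ := exists_space_estimate F
  obtain ⟨C₂, hC₂, H₂⟩ := exists_dof_estimate F
  obtain ⟨m, hm⟩ := exists_card_nodes_bound F
  obtain ⟨N, hN⟩ := exists_overlap_bound F
  -- The summand `1` only secures positivity, since `m * N` may vanish.
  refine ⟨C₁ * C₂ * (m * N) + 1, by positivity, fun h hh M _ κ hκ w => ?_⟩
  let I : M.cells → ℝ := fun T => intSq (T.1.carrier h) (w T).1
  have hI : ∀ T, 0 ≤ I T := fun T => intSq_nonneg _ _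
  have h1 : ∀ T : M.cells, intSq (T.1.carrier h) (M.average κ w T).1 ≤
      C₁ * ∑ x ∈ T.1.nodes h, ∑ T' ∈ M.cellsAt x, C₂ * I T' := by
    intro T
    refine (H₁ h hh T.1 _ (M.average_apply_mem_space hh w T)).trans
      (mul_le_mul_of_nonneg_left (Finset.sum_le_sum fun x hx => ?_) hC₁.le)
    have hxM := Mesh.mem_nodes hx
    rw [M.dof_average hh w hx, mul_pow, ← mul_assoc]
    refine (mul_le_mul_of_nonneg_left (M.nodalAverage_sq_le hκ w hxM) (by positivity)).trans ?_
    rw [Finset.mul_sum]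
    refine Finset.sum_le_sum fun T' hT' => ?_
    rw [mul_assoc, ← mul_pow]
    exact H₂ h hh T'.1 (w T') x (Mesh.mem_cellNodes hxM hT')
  have h2 : ∑ T : M.cells, ∑ x ∈ T.1.nodes h, ∑ T' ∈ M.cellsAt x, C₂ * I T' ≤
      ∑ T' : M.cells, C₂ * (m * N) * I T' := by
    -- The triples `(T, x, T')` are those in which `x` is a node of both elements, a condition
    -- symmetric in `T` and `T'`.
    have h3 : ∑ T : M.cells, ∑ x ∈ T.1.nodes h, ∑ T' ∈ M.cellsAt x, C₂ * I T' =
        ∑ T' : M.cells, ∑ x ∈ T'.1.nodes h, ∑ T ∈ M.cellsAt x, C₂ * I T' := by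
      simp only [Finset.sum_sigma']
      refine Finset.sum_bij' (fun z _ => ⟨z.2.2, z.2.1, z.1⟩) (fun z _ => ⟨z.2.2, z.2.1, z.1⟩)
        ?_ ?_ (fun _ _ => rfl) (fun _ _ => rfl) (fun _ _ => rfl) <;>
      · rintro ⟨T, x, T'⟩ hz
        simp only [Finset.mem_sigma, Finset.mem_univ, true_and] at hz ⊢
        exact ⟨Mesh.mem_cellNodes (Mesh.mem_nodes hz.1) hz.2, Mesh.mem_cellsAt hz.1⟩
    rw [h3]
    refine Finset.sum_le_sum fun T' _ => ?_
    have h4 : ∀ x ∈ T'.1.nodes h, ∑ T ∈ M.cellsAt x, C₂ * I T' ≤ N * (C₂ * I T') := by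
      intro x _
      rw [Finset.sum_const, nsmul_eq_mul]
      have := hI T'
      gcongr
      exact hN h hh M x
    refine (Finset.sum_le_sum h4).trans ?_
    rw [Finset.sum_const, nsmul_eq_mul]
    have h5 : ((T'.1.nodes h).card : ℝ) ≤ m := by exact_mod_cast hm h T'.1
    have h6 : 0 ≤ N * (C₂ * I T') := mul_nonneg N.cast_nonneg (mul_nonneg hC₂.le (hI T'))
    calc _ ≤ m * (N * (C₂ * I T')) := mul_le_mul_of_nonneg_right h5 h6
      _ = _ := by ring
  calc M.l2sq (M.average κ w)
      ≤ ∑ T : M.cells, C₁ * ∑ x ∈ T.1.nodes h, ∑ T' ∈ M.cellsAt x, C₂ * I T' :=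
        Finset.sum_le_sum fun T _ => h1 T
    _ ≤ C₁ * ∑ T' : M.cells, C₂ * (m * N) * I T' := by
        rw [← Finset.mul_sum]
        exact mul_le_mul_of_nonneg_left h2 hC₁.le
    _ = C₁ * C₂ * (m * N) * M.l2sq w := by
        rw [← Finset.mul_sum, Mesh.l2sq]
        ring
    _ ≤ _ := mul_le_mul_of_nonneg_right (by linarith) (M.l2sq_nonneg w)

/-- Inverse estimate for the elementwise derivatives of order `j`, uniformly in `j`. -/
theorem exists_gradSq_le : ∃ C : ℝ, 0 < C ∧ ∀ h : ℝ, 0 < h → ∀ (M : Mesh F h)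
    [Fintype M.cells] (j : ℕ) (w : M.Wh), (h ^ j) ^ 2 * M.gradSq j w ≤ C * M.l2sq w := by
  obtain ⟨C, hC, H⟩ := exists_inverse_estimate F
  have Hj : ∀ h : ℝ, 0 < h → ∀ (T : Cell F) (j : ℕ) (s : Fin j → Fin d),
      ∀ p ∈ MvPolynomial.restrictTotalDegree (Fin d) ℝ k,
      (h ^ j) ^ 2 * intSq (T.carrier h) (tensorDeriv s p) ≤ C ^ j * intSq (T.carrier h) p := by
    intro h hh T j
    induction j with
    | zero => intro s p _; simp [tensorDeriv]
    | succ n ih =>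
      intro s p hp
      have h1 : tensorDeriv s p =
          MvPolynomial.pderiv (s 0) (tensorDeriv (fun i => s i.succ) p) := by
        simp [tensorDeriv, List.ofFn_succ]
      have hq : tensorDeriv (fun i => s i.succ) p ∈
          MvPolynomial.restrictTotalDegree (Fin d) ℝ k := by
        rw [MvPolynomial.mem_restrictTotalDegree] at hp ⊢
        exact (totalDegree_tensorDeriv_le _ p).trans (by omega)
      have h2 := H h hh T _ hq (s 0)
      have h3 := ih (fun i => s i.succ) p hp
      rw [h1]
      calc _ = (h ^ n) ^ 2 * (h ^ 2 * intSq (T.carrier h)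
              (MvPolynomial.pderiv (s 0) (tensorDeriv (fun i => s i.succ) p))) := by ring
        _ ≤ (h ^ n) ^ 2 * (C * intSq (T.carrier h) (tensorDeriv (fun i => s i.succ) p)) := by
            gcongr
        _ = C * ((h ^ n) ^ 2 * intSq (T.carrier h) (tensorDeriv (fun i => s i.succ) p)) := by
            ring
        _ ≤ C * (C ^ n * intSq (T.carrier h) p) := by gcongr
        _ = _ := by ring
  -- There are `d ^ j` index tuples, each costing `C ^ j`; for `j ≤ k` the product is at most this
  -- constant, and for `j > k` the derivatives vanish.
  refine ⟨max 1 (d * C) ^ k, by positivity, fun h hh M _ j w => ?_⟩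
  rw [Mesh.gradSq, Mesh.l2sq, Finset.mul_sum, Finset.mul_sum]
  refine Finset.sum_le_sum fun T _ => ?_
  have hI := intSq_nonneg (T.1.carrier h) (w T).1
  by_cases hj : k < j
  · simp only [tensorDeriv_eq_zero hj _ (w T).2, intSq_zero, Finset.sum_const_zero, mul_zero]
    positivity
  · rw [Finset.mul_sum]
    refine (Finset.sum_le_sum fun s _ => Hj h hh T.1 j s _ (w T).2).trans ?_
    rw [Finset.sum_const, Finset.card_univ, Fintype.card_fun, Fintype.card_fin, Fintype.card_fin,
      nsmul_eq_mul, ← mul_assoc, Nat.cast_pow, ← mul_pow]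
    refine mul_le_mul_of_nonneg_right ?_ hI
    exact (pow_le_pow_left₀ (by positivity) (le_max_right _ _) j).trans
      (pow_le_pow_right₀ (le_max_left _ _) (by omega))

/-- The nodal averaging operator is a projection onto `V_h` which is stable in `L²` and satisfies
the error bound in the broken Sobolev seminorms. -/
theorem exists_average_bounds : ∃ C : ℝ, 0 < C ∧ ∀ h : ℝ, 0 < h → ∀ (M : Mesh F h)
    [Fintype M.cells] (κ : M.cells → GenNode d → ℝ), M.IsWeight κ →
    (∀ w, M.l2norm (M.average κ w) ≤ C * M.l2norm w) ∧
    ∀ (j : ℕ) (w : M.Wh), M.gradNorm j (M.average κ w) ≤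
      C * ((h ^ j)⁻¹ * (⨅ v' : M.Vh, M.l2norm (w - v'.1)) + M.gradNorm j w) := by
  obtain ⟨C₁, hC₁, H₁⟩ := exists_l2sq_average_le F
  obtain ⟨C₂, hC₂, H₂⟩ := exists_gradSq_le F
  -- The summand `2` absorbs the factor in front of `gradSq j w` and forces `C ≥ 1`. Then `C ≤ C ^
  -- 2`, so `C ^ 2` dominates every constant arising for squared norms.
  set C : ℝ := C₁ + 4 * C₂ * (C₁ + 1) + 2 with hCdef
  have hprod : 0 < 4 * C₂ * (C₁ + 1) := by positivity
  have hC : 0 < C := by positivity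
  have hCC : C ≤ C ^ 2 := by nlinarith
  refine ⟨C, hC, fun h hh M _ κ hκ => ⟨fun w => ?_, fun j w => ?_⟩⟩
  · have hw := M.l2sq_nonneg w
    rw [M.l2norm_eq, M.l2norm_eq]
    refine Real.sqrt_le_iff.2 ⟨by positivity, ?_⟩
    rw [mul_pow, Real.sq_sqrt hw]
    exact (H₁ h hh M κ hκ w).trans (mul_le_mul_of_nonneg_right (by linarith) hw)
  · have hlin := M.isLinearMap_average κ
    have key : ∀ v' : M.Vh, M.gradNorm j (M.average κ w) ≤
        C * ((h ^ j)⁻¹ * M.l2norm (w - v'.1) + M.gradNorm j w) := by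
      intro v'
      set u := w - v'.1 with hu
      have hsplit : M.average κ w = (M.average κ u - u) + w := by
        have h1 : M.average κ u = M.average κ w - v'.1 := by
          rw [hu, hlin.map_sub, M.average_eq_self hh hκ v'.2]
        rw [h1, hu]
        abel
      have h2 := M.gradSq_add_le j (M.average κ u - u) w
      rw [← hsplit] at h2
      have h3 := H₂ h hh M j (M.average κ u - u)
      have h4 := M.l2sq_sub_le (M.average κ u) u
      have h5 := H₁ h hh M κ hκ u
      have hL := M.l2sq_nonneg u
      have hG := M.gradSq_nonneg j w
      have hpos : 0 < h ^ j := pow_pos hh j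
      have h6 : M.gradSq j (M.average κ u - u) ≤
          2 * C₂ * (C₁ + 1) * (((h ^ j)⁻¹) ^ 2 * M.l2sq u) := by
        have h7 : (h ^ j) ^ 2 * M.gradSq j (M.average κ u - u) ≤
            2 * C₂ * (C₁ + 1) * M.l2sq u :=
          h3.trans ((mul_le_mul_of_nonneg_left (by linarith :
            M.l2sq (M.average κ u - u) ≤ 2 * (C₁ + 1) * M.l2sq u) hC₂.le).trans_eq (by ring))
        rw [inv_pow, ← mul_assoc, mul_right_comm, ← div_eq_mul_inv,
          le_div_iff₀ (pow_pos hpos 2), mul_comm]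
        exact h7
      rw [M.gradNorm_eq, M.gradNorm_eq, M.l2norm_eq]
      refine Real.sqrt_le_iff.2 ⟨by positivity, ?_⟩
      -- Nonnegativity of the cross term gives `a² + b² ≤ (a + b)²` below.
      have h8 : 0 ≤ (h ^ j)⁻¹ * √(M.l2sq u) * √(M.gradSq j w) := by positivity
      have h9 : 0 ≤ ((h ^ j)⁻¹) ^ 2 * M.l2sq u := by positivity
      calc M.gradSq j (M.average κ w)
          ≤ 4 * C₂ * (C₁ + 1) * (((h ^ j)⁻¹) ^ 2 * M.l2sq u) + 2 * M.gradSq j w := by linarith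
        _ ≤ C ^ 2 * (((h ^ j)⁻¹) ^ 2 * M.l2sq u) + C ^ 2 * M.gradSq j w := by
            gcongr <;> linarith
        _ = C ^ 2 * (((h ^ j)⁻¹ * √(M.l2sq u)) ^ 2 + √(M.gradSq j w) ^ 2) := by
            rw [mul_pow, Real.sq_sqrt hL, Real.sq_sqrt hG, mul_add]
        _ ≤ C ^ 2 * ((h ^ j)⁻¹ * √(M.l2sq u) + √(M.gradSq j w)) ^ 2 := by
            gcongr
            linarith [add_sq ((h ^ j)⁻¹ * √(M.l2sq u)) (√(M.gradSq j w))]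
        _ = _ := by rw [mul_pow]
    have hpos : 0 < h ^ j := pow_pos hh j
    -- The bound for each `v'` is solved for `l2norm (w - v')`, so that its other side is a lower
    -- bound independent of `v'`.
    have h1 : h ^ j * (M.gradNorm j (M.average κ w) / C - M.gradNorm j w) ≤
        ⨅ v' : M.Vh, M.l2norm (w - v'.1) := by
      refine le_ciInf fun v' => ?_
      have h2 := key v'
      rw [← div_le_iff₀' hC, ← sub_le_iff_le_add, ← div_eq_inv_mul, le_div_iff₀' hpos] at h2
      exact h2
    rw [← div_le_iff₀' hC, ← sub_le_iff_le_add, ← div_eq_inv_mul, le_div_iff₀' hpos]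
    exact h1

end Stability

end NodalFEM

end

theorem mainTheorem8 {d k : ℕ} {ρ : Type} [Finite ρ] (F : NodalFEM.ElementFamily d k ρ) :
    ∃ C : ℝ, 0 < C ∧
      ∀ (h : ℝ), 0 < h → ∀ (M : NodalFEM.Mesh F h) (Ω : Set (Fin d → ℝ))
        [Fintype (M.active Ω).cells]
        (κ : (M.active Ω).cells → NodalFEM.GenNode d → ℝ), (M.active Ω).IsWeight κ →
        (∀ w, (M.active Ω).average κ w ∈ (M.active Ω).Vh) ∧
        IsLinearMap ℝ ((M.active Ω).average κ) ∧
        (∀ v ∈ (M.active Ω).Vh, (M.active Ω).average κ v = v) ∧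
        (∀ w, (M.active Ω).l2norm ((M.active Ω).average κ w) ≤ C * (M.active Ω).l2norm w) ∧
        (∀ (j : ℕ) (w : (M.active Ω).Wh),
          (M.active Ω).gradNorm j ((M.active Ω).average κ w) ≤
            C * ((h ^ j)⁻¹ * (⨅ v' : (M.active Ω).Vh, (M.active Ω).l2norm (w - v'.1)) +
              (M.active Ω).gradNorm j w)) := by
  obtain ⟨C, hC, H⟩ := NodalFEM.exists_average_bounds F
  refine ⟨C, hC, fun h hh M Ω _ κ hκ => ?_⟩
  obtain ⟨hL2, hgrad⟩ := H h hh (M.active Ω) κ hκ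
  exact ⟨(M.active Ω).average_mem_Vh κ, (M.active Ω).isLinearMap_average κ,
    fun v hv => (M.active Ω).average_eq_self hh hκ hv, hL2, hgrad⟩
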